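/- Let $\mathbb F$ be a field of characteristic $p>3$, let $n\ge 3$ and let $\underline t=(t_1,\dots,t_n)$ be a tuple of positive integers. Let $\mathcal O(n,n)=\mathcal O(n)\otimes\Lambda(n)$ be the tensor product of the divided power algebra with basis $x^{(\alpha)}$ ($\alpha\in\mathbb N_0^n$; write $x_i=x^{(\varepsilon_i)}$, $1\le i\le n$) and the exterior algebra on odd generators $x_{n+1},\dots,x_{2n}$, with basis the $x^{(\alpha)}x^u$ ($u=\{i_1<\dots<i_k\}\subseteq\{n+1,\dots,2n\}$, $x^u=x_{i_1}\cdots x_{i_k}$, $|u|=k$), and let $\partial_1,\dots,\partial_{2n}$ be the superderivations of $\mathcal O(n,n)$ given by $\partial_r(x^{(\alpha)}x^u)=x^{(\alpha-\varepsilon_r)}x^u$ for $r\le n$ (zero if $\alpha_r=0$) and $\partial_r(x^{(\alpha)}x^u)=x^{(\alpha)}\,\partial x^u/\partial x_r$ for $r>n$. Let $\mathcal O(n,n;\underline t)$ be the span of the $x^{(\alpha)}x^u$ with $\alpha_i<p^{t_i}$ for all $i$, graded by $\deg x^{(\alpha)}x^u=|\alpha|+|u|$, and let $W(n,n;\underline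 t)=\{\sum_{r=1}^{2n} f_r\partial_r : f_r\in\mathcal O(n,n;\underline t)\}$, a Lie superalgebra with $\mathbb Z$-gradation $W(n,n;\underline t)_k=\{\sum_r f_r\partial_r : f_r\in\mathcal O(n,n;\underline t)_{k+1}\}$. Put $i'=i+n$ and $\mu(i)=0$ for $i\le n$, and $i'=i-n$ and $\mu(i)=1$ for $i>n$. Let $\mathrm{T_H}$ be the linear map with $\mathrm{T_H}(a)=\sum_{i=1}^{2n}(-1)^{\mu(i)\mathrm p(a)}\partial_i(a)\partial_{i'}$ for $\mathbb Z_2$-homogeneous $a$ of parity $\mathrm p(a)$, and let $HO(n,n;\underline t)=\mathrm{T_H}(\mathcal O(n,n;\underline t))$. Let $\mathcal W$ and $\mathcal{HO}$ be the even parts of $W(n,n;\underline t)$ and $HO(n,n;\underline t)$; they are $\mathbb Z$-graded Lie algebras with $\mathcal W_k=\mathcal W\cap W(n,n;\underline t)_k$ and $\mathcal{HO}_k=\mathcal{HO}\cap\mathcal W_k$. Let $\mathrm{Der}_k(\mathcal{HO})$ be the space of derivations $\phi$ of $\mathcal{HO}$ with $\phi(\mathcal{HO}_i)\subseteq\mathcal{HO}_{k+i}$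 for all $i\in\mathbb Z$, and put $\Gamma=\sum_{i=1}^n x_{i'}\partial_{i'}\in\mathcal W$. For a subspace $V\subseteq\mathcal W$ write $V_k=V\cap\mathcal W_k$, and $\mathrm{ad}\,V$ for the set of maps $x\mapsto[E,x]$ on $\mathcal{HO}$ with $E\in V$. Then: 1. $\mathrm{Der}_k(\mathcal{HO})=\mathrm{ad}\,\mathcal{HO}_k$ for every integer $k>0$; 2. $\mathrm{Der}_0(\mathcal{HO})=\mathrm{ad}\,(\mathcal{HO}+\mathbb F\Gamma)_0$; 3. for every integer $k\ge 0$, the elements of $\mathcal W_k$ that normalize $\mathcal{HO}$ are exactly those of $(\mathcal{HO}+\mathbb F\Gamma)_k$. -/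

import Mathlib

namespace OddHamiltonian

/-- The index set `Y = Y₀ ∪ Y₁` of the `2n` variables. The element `Sum.inl i` is the index `i` in
`Y₀ = {1, …, n}`, and `Sum.inr i` is the index `i' = i + n` in `Y₁ = {n + 1, …, 2n}`; the involution
`r ↦ r'` is `Sum.swap`. -/
abbrev Y (n : ℕ) : Type := Fin n ⊕ Fin n

/-- The parity `μ` of the indices. -/
def mu {n : ℕ} : Y n → ℕ
  | Sum.inl _ => 0
  | Sum.inr _ => 1

@[simp] theorem mu_inl {n : ℕ} (i : Fin n) : mu (Sum.inl i : Y n) = 0 := rfl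

@[simp] theorem mu_inr {n : ℕ} (i : Fin n) : mu (Sum.inr i : Y n) = 1 := rfl

/-- The underlying space of `𝒪(n, n) = 𝒪(n) ⊗ Λ(n)`: the free `F`-module on the symbols
`x^(α) x^u` with `α ∈ ℕ₀ⁿ` and `u` a set of odd variables (written in increasing order). -/
abbrev OO (F : Type*) [Field F] (n : ℕ) : Type _ := ((Fin n → ℕ) × Finset (Fin n)) →₀ F

variable (F : Type*) [Field F] (n : ℕ)

/-- The basis element `x^(α) x^u`. -/
noncomputable def mon (α : Fin n → ℕ) (u : Finset (Fin n)) : OO F n := Finsupp.single (α, u) 1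

/-- The number of pairs `(i, j) ∈ u × v` with `j < i`: the number of transpositions needed to
bring the product `x^u x^v` to increasing order. -/
def inv {n : ℕ} (u v : Finset (Fin n)) : ℕ := ((u ×ˢ v).filter (fun q => q.2 < q.1)).card

/-- The sign in `x^u x^v = ± x^(u ∪ v)` (zero if `u` and `v` meet). -/
def eps {n : ℕ} (u v : Finset (Fin n)) : F := if Disjoint u v then (-1) ^ inv u v else 0

/-- The multi-binomial coefficient `binom (α + β) α`. -/
def binom {n : ℕ} (α β : Fin n → ℕ) : ℕ := ∏ i, (α i + β i).choose (α i)

/-- The multiplication of `𝒪(n, n)`: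
`x^(α) x^u · x^(β) x^v = binom (α + β) α · x^(α + β) · (x^u x^v)`. -/
noncomputable def mul : OO F n →ₗ[F] OO F n →ₗ[F] OO F n :=
  Finsupp.linearCombination F fun a => Finsupp.linearCombination F fun b =>
    ((binom a.1 b.1 : F) * eps F a.2 b.2) • mon F n (a.1 + b.1) (a.2 ∪ b.2)

/-- The superderivations `∂_r`, `r ∈ Y`, of `𝒪(n, n)`; for odd `r` the sign comes from moving the
variable `x_r` to the front of `x^u`. -/
noncomputable def pd : Y n → (OO F n →ₗ[F] OO F n)
  | Sum.inl i => Finsupp.linearCombination F fun a =>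
      if a.1 i = 0 then 0 else mon F n (a.1 - Pi.single i 1) a.2
  | Sum.inr i => Finsupp.linearCombination F fun a =>
      if i ∈ a.2 then ((-1) ^ (a.2.filter (fun j => j < i)).card : F) • mon F n a.1 (a.2.erase i)
      else 0

/-- The parity involution: `a ↦ (-1)^(p(a)) a` on homogeneous elements. -/
noncomputable def sig : OO F n →ₗ[F] OO F n :=
  Finsupp.linearCombination F fun a => ((-1) ^ a.2.card : F) • mon F n a.1 a.2

/-- The variable `x_r`, `r ∈ Y`. -/
noncomputable def X : Y n → OO F n
  | Sum.inl i => mon F n (Pi.single i 1) ∅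
  | Sum.inr i => mon F n 0 {i}

/-- The `ℤ₂`-homogeneous component of `𝒪(n, n)` of parity `θ`. -/
noncomputable def par (θ : ℕ) : Submodule F (OO F n) :=
  Finsupp.supported F F {a | a.2.card ≡ θ [MOD 2]}

variable {n}

/-- The truncated algebra `𝒪(n, n; t) = span {x^(α) x^u | α_i ≤ p^(t_i) - 1}`. -/
noncomputable def OT (p : ℕ) (t : Fin n → ℕ) : Submodule F (OO F n) :=
  Finsupp.supported F F {a | ∀ i, a.1 i < p ^ t i}

/-- The component `𝒪(n, n; t)_k = span {x^(α) x^u | |α| + |u| = k}` of the `ℤ`-gradation. -/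
noncomputable def OTdeg (p : ℕ) (t : Fin n → ℕ) (k : ℤ) : Submodule F (OO F n) :=
  Finsupp.supported F F {a | (∀ i, a.1 i < p ^ t i) ∧ ((∑ i, a.1 i + a.2.card : ℕ) : ℤ) = k}

/-- The operator `∑_{r ∈ Y} f_r ∂_r` on `𝒪(n, n)` with coefficients `f`. -/
noncomputable def vf : (Y n → OO F n) →ₗ[F] Module.End F (OO F n) :=
  ∑ r, (LinearMap.lcomp F (OO F n) (pd F n r)) ∘ₗ mul F n ∘ₗ LinearMap.proj r

/-- `T_H(a) = ∑_{r ∈ Y} (-1)^(μ(r) p(a)) ∂_r(a) ∂_{r'}`. -/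
noncomputable def TH : OO F n →ₗ[F] Module.End F (OO F n) :=
  ∑ r, (LinearMap.lcomp F (OO F n) (pd F n r.swap)) ∘ₗ mul F n ∘ₗ pd F n r ∘ₗ sig F n ^ mu r

/-- The subspace of parity `θ` of `W(n, n; t) = {∑ f_r ∂_r | f_r ∈ 𝒪(n, n; t)}`. -/
noncomputable def Wpar (p : ℕ) (t : Fin n → ℕ) (θ : ℕ) : Submodule F (Module.End F (OO F n)) :=
  (Submodule.pi Set.univ fun r => OT F p t ⊓ par F n (θ + mu r)).map (vf F)

theorem vf_apply (f : Y n → OO F n) (h : OO F n) : vf F f h = ∑ r, mul F n (f r) (pd F n r h) := by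
  simp [vf]

theorem TH_apply (a h : OO F n) :
    TH F a h = ∑ r : Y n, mul F n (pd F n r ((sig F n ^ mu r) a)) (pd F n r.swap h) := by
  simp [TH]


theorem mul_mon (α β : Fin n → ℕ) (u v : Finset (Fin n)) :
    mul F n (mon F n α u) (mon F n β v) =
      ((binom α β : F) * eps F u v) • mon F n (α + β) (u ∪ v) := by
  simp [mul, mon]

theorem pd_inl_mon (i : Fin n) (α : Fin n → ℕ) (u : Finset (Fin n)) :
    pd F n (Sum.inl i) (mon F n α u) = if α i = 0 then 0 else mon F n (α - Pi.single i 1) u := by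
  simp [pd, mon]

theorem pd_inr_mon (i : Fin n) (α : Fin n → ℕ) (u : Finset (Fin n)) :
    pd F n (Sum.inr i) (mon F n α u) =
      if i ∈ u then ((-1) ^ inv {i} u : F) • mon F n α (u.erase i) else 0 := by
  have : inv {i} u = (u.filter (fun j => j < i)).card := by
    unfold inv
    apply Finset.card_bij (fun q _ => q.2)
    · rintro ⟨a, b⟩ h; grind
    · rintro ⟨a, b⟩ h ⟨c, d⟩ h' e; simp_all
    · intro b hb; exact ⟨(i, b), by simpa using hb, rfl⟩
  rw [this]
  simp [pd, mon]

theorem sig_mon (α : Fin n → ℕ) (u : Finset (Fin n)) :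
    sig F n (mon F n α u) = ((-1) ^ u.card : F) • mon F n α u := by
  simp [sig, mon]

/-- Linear maps out of `𝒪(n, n)` agree if they agree on the standard basis. -/
theorem hom_ext {M : Type*} [AddCommGroup M] [Module F M] {f g : OO F n →ₗ[F] M}
    (h : ∀ α u, f (mon F n α u) = g (mon F n α u)) : f = g := by
  apply Finsupp.lhom_ext
  rintro ⟨α, u⟩ c
  have : (Finsupp.single (α, u) c : OO F n) = c • mon F n α u := by simp [mon]
  rw [this, map_smul, map_smul, h]

theorem inv_eq (u v : Finset (Fin n)) : inv u v = ∑ i ∈ u, ∑ j ∈ v, if j < i then 1 else 0 := by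
  rw [inv, Finset.card_filter, Finset.sum_product]

theorem inv_union_left {u v : Finset (Fin n)} (h : Disjoint u v) (w : Finset (Fin n)) :
    inv (u ∪ v) w = inv u w + inv v w := by
  simp only [inv_eq, Finset.sum_union h]

theorem inv_union_right {v w : Finset (Fin n)} (h : Disjoint v w) (u : Finset (Fin n)) :
    inv u (v ∪ w) = inv u v + inv u w := by
  simp only [inv_eq, Finset.sum_union h, Finset.sum_add_distrib]

theorem inv_add_swap {u v : Finset (Fin n)} (h : Disjoint u v) :
    inv u v + inv v u = u.card * v.card := by
  rw [inv_eq, inv_eq, Finset.sum_comm (s := v), ← Finset.sum_add_distrib]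
  have : ∀ i ∈ u, (∑ j ∈ v, if j < i then 1 else 0) + (∑ j ∈ v, if i < j then 1 else 0) =
      v.card := by
    intro i hi
    rw [← Finset.sum_add_distrib, Finset.card_eq_sum_ones]
    apply Finset.sum_congr rfl
    intro j hj
    have : i ≠ j := fun e => Finset.disjoint_left.1 h hi (e ▸ hj)
    split_ifs <;> grind
  rw [Finset.sum_congr rfl this]; simp

theorem eps_swap (u v : Finset (Fin n)) : eps F u v = (-1) ^ (u.card * v.card) * eps F v u := by
  unfold eps
  by_cases h : Disjoint u v
  · rw [if_pos h, if_pos h.symm, ← inv_add_swap h, pow_add, mul_assoc, ← pow_add, ← two_mul,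
      pow_mul (-1 : F) 2]
    simp
  · rw [if_neg h, if_neg (fun h' => h h'.symm)]; simp

theorem eps_assoc (u v w : Finset (Fin n)) :
    eps F u v * eps F (u ∪ v) w = eps F v w * eps F u (v ∪ w) := by
  unfold eps
  by_cases h1 : Disjoint u v <;> by_cases h2 : Disjoint v w <;> by_cases h3 : Disjoint u w <;>
    simp only [h1, h2, h3, Finset.disjoint_union_left, Finset.disjoint_union_right, if_true,
      if_false, and_self, and_false, mul_zero, zero_mul, and_true]
  rw [inv_union_left h1, inv_union_right h2]
  ring

theorem binom_comm (α β : Fin n → ℕ) : binom α β = binom β α := by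
  unfold binom
  refine Finset.prod_congr rfl fun i _ => ?_
  rw [Nat.choose_symm_add, add_comm]

theorem binom_assoc (α β γ : Fin n → ℕ) :
    binom α β * binom (α + β) γ = binom β γ * binom α (β + γ) := by
  unfold binom
  rw [← Finset.prod_mul_distrib, ← Finset.prod_mul_distrib]
  refine Finset.prod_congr rfl fun i _ => ?_
  simp only [Pi.add_apply]
  have h := Nat.choose_mul (n := α i + β i + γ i) (k := α i + β i) (s := α i) (by omega)
  rw [show α i + β i + γ i - α i = β i + γ i by omega,
    show α i + β i - α i = β i by omega] at h
  rw [mul_comm, h, mul_comm, add_assoc]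

theorem mul_assoc' (a b c : OO F n) : mul F n (mul F n a b) c = mul F n a (mul F n b c) := by
  have h1 : (mul F n).flip c ∘ₗ (mul F n).flip b = (mul F n).flip (mul F n b c) := by
    refine hom_ext F fun α u => ?_
    have h2 : (mul F n).flip c ∘ₗ mul F n (mon F n α u)
        = mul F n (mon F n α u) ∘ₗ (mul F n).flip c := by
      refine hom_ext F fun β v => ?_
      have h3 : mul F n (mul F n (mon F n α u) (mon F n β v))
          = mul F n (mon F n α u) ∘ₗ mul F n (mon F n β v) := by
        refine hom_ext F fun γ w => ?_
        simp only [LinearMap.comp_apply, mul_mon, map_smul, LinearMap.smul_apply, smul_smul,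
          add_assoc, Finset.union_assoc]
        congr 1
        have e1 := eps_assoc F u v w
        have e2 := congrArg (Nat.cast (R := F)) (binom_assoc α β γ)
        push_cast at e2
        linear_combination (eps F u v * eps F (u ∪ v) w) * e2 +
          ((binom β γ : F) * binom α (β + γ)) * e1
      exact congrArg (fun f => f c) h3
    exact congrArg (fun f => f b) h2
  exact congrArg (fun f => f a) h1

theorem eps_sq {u v : Finset (Fin n)} (h : Disjoint u v) : eps F u v * eps F u v = 1 := by
  rw [eps, if_pos h, ← pow_add, ← two_mul, pow_mul]; simp

theorem neg_one_pow_sq (k : ℕ) : ((-1) ^ k : F) * (-1) ^ k = 1 := by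
  rw [← pow_add, ← two_mul, pow_mul]; simp

theorem sign_eq {i : Fin n} {u : Finset (Fin n)} (h : i ∈ u) :
    ((-1) ^ inv {i} u : F) = eps F {i} (u.erase i) := by
  rw [eps, if_pos (by simp)]
  congr 1
  simp [inv_eq, ← Finset.add_sum_erase u _ h]

theorem pd_inr_mon' (i : Fin n) (α : Fin n → ℕ) (u : Finset (Fin n)) :
    pd F n (Sum.inr i) (mon F n α u) =
      if i ∈ u then eps F {i} (u.erase i) • mon F n α (u.erase i) else 0 := by
  rw [pd_inr_mon]
  split_ifs with h
  · rw [sign_eq F h]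
  · rfl

theorem sig_pow_mon (k : ℕ) (α : Fin n → ℕ) (u : Finset (Fin n)) :
    (sig F n ^ k) (mon F n α u) = ((-1) ^ (k * u.card) : F) • mon F n α u := by
  induction k with
  | zero => simp
  | succ k ih =>
    rw [pow_succ', Module.End.mul_apply, ih, map_smul, sig_mon, smul_smul, ← pow_add]
    congr 2; ring

theorem binom_pascal (i : Fin n) (α β : Fin n → ℕ) :
    (if α i + β i = 0 then 0 else binom α β) =
      (if α i = 0 then 0 else binom (α - Pi.single i 1) β) +
      (if β i = 0 then 0 else binom α (β - Pi.single i 1)) := by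
  have e : ∀ α β : Fin n → ℕ, binom α β = (α i + β i).choose (α i) *
      ∏ j ∈ Finset.univ.erase i, (α j + β j).choose (α j) := fun α β =>
    (Finset.mul_prod_erase _ _ (Finset.mem_univ i)).symm
  have e1 : ∏ j ∈ Finset.univ.erase i, ((α - Pi.single i 1 : Fin n → ℕ) j + β j).choose ((α - Pi.single i 1 : Fin n → ℕ) j)
      = ∏ j ∈ Finset.univ.erase i, (α j + β j).choose (α j) := by
    refine Finset.prod_congr rfl fun j hj => ?_
    have : j ≠ i := Finset.ne_of_mem_erase hj
    simp [Pi.single_eq_of_ne this]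
  have e2 : ∏ j ∈ Finset.univ.erase i, (α j + (β - Pi.single i 1 : Fin n → ℕ) j).choose (α j)
      = ∏ j ∈ Finset.univ.erase i, (α j + β j).choose (α j) := by
    refine Finset.prod_congr rfl fun j hj => ?_
    have : j ≠ i := Finset.ne_of_mem_erase hj
    simp [Pi.single_eq_of_ne this]
  rw [e, e, e, e1, e2]
  simp only [Pi.sub_apply, Pi.single_eq_same]
  generalize ∏ j ∈ Finset.univ.erase i, (α j + β j).choose (α j) = P
  rcases α i with _ | a <;> rcases hb : β i with _ | b <;> simp
  rw [show a + 1 + (b + 1) = (a + b + 1) + 1 by ring, Nat.choose_succ_succ,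
    show a + (b + 1) = a + b + 1 by ring, show a + 1 + b = a + b + 1 by ring]
  ring

theorem pd_mul_mon (r : Y n) (α β : Fin n → ℕ) (u v : Finset (Fin n)) :
    pd F n r (mul F n (mon F n α u) (mon F n β v)) =
      mul F n (pd F n r (mon F n α u)) (mon F n β v) +
      mul F n ((sig F n ^ mu r) (mon F n α u)) (pd F n r (mon F n β v)) := by
  rw [sig_pow_mon, mul_mon, map_smul]
  rcases r with i | i
  · simp only [pd_inl_mon, mu, Pi.add_apply]
    have e := congrArg (Nat.cast (R := F)) (binom_pascal i α β)
    have s1 : α i ≠ 0 → α - Pi.single i 1 + β = α + β - Pi.single i 1 := by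
      intro h; ext j; by_cases hj : j = i
      · subst hj; simp; omega
      · simp [Pi.single_eq_of_ne hj]
    have s2 : β i ≠ 0 → α + (β - Pi.single i 1) = α + β - Pi.single i 1 := by
      intro h; ext j; by_cases hj : j = i
      · subst hj; simp; omega
      · simp [Pi.single_eq_of_ne hj]
    by_cases h1 : α i = 0 <;> by_cases h2 : β i = 0
    · simp [h1, h2]
    · simp only [h1, h2, s2, zero_add, if_true, if_false, zero_mul, pow_zero, one_smul, map_zero,
        LinearMap.zero_apply, mul_mon, ne_eq, not_false_eq_true] at e ⊢
      rw [e]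
    · simp only [h1, h2, s1, add_zero, if_true, if_false, zero_mul, pow_zero, one_smul, map_zero,
        mul_mon, ne_eq, not_false_eq_true] at e ⊢
      rw [e]
    · simp only [h1, h2, s1, s2, Nat.add_eq_zero_iff, false_and, if_false, zero_mul, pow_zero,
        one_smul, mul_mon, ne_eq, not_false_eq_true, ← add_smul] at e ⊢
      rw [e]; push_cast; rw [add_mul]
  · simp only [pd_inr_mon', mu, one_mul, Finset.mem_union]
    by_cases h1 : i ∈ u <;> by_cases h2 : i ∈ v
    · have e0 : eps F u v = 0 := if_neg fun h => Finset.disjoint_left.1 h h1 h2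
      simp only [h1, h2, or_self, if_true, e0, mul_zero, zero_mul, zero_smul, map_smul, LinearMap.smul_apply,
        mul_mon, smul_smul]
      have s : u.erase i ∪ v = u ∪ v.erase i := by grind
      rw [s, ← add_smul, eq_comm]
      convert! zero_smul F _
      have a1 := eps_assoc F (u.erase i) {i} (v.erase i)
      have k1 : u.erase i ∪ {i} = u := by grind
      have k2 : {i} ∪ v.erase i = v := by grind
      rw [k1, k2, eps_swap F (u.erase i) {i}] at a1
      have q1 := eps_sq F (u := {i}) (v := u.erase i) (by simp)
      have q2 := eps_sq F (u := {i}) (v := v.erase i) (by simp)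
      have q3 := neg_one_pow_sq F (u.erase i).card
      have hc : u.card = (u.erase i).card + 1 := (Finset.card_erase_add_one h1).symm
      rw [hc, pow_succ]
      simp only [Finset.card_singleton, mul_one] at a1
      generalize eps F {i} (u.erase i) = A at *
      generalize eps F {i} (v.erase i) = B at *
      generalize eps F (u.erase i) v = C at *
      generalize eps F u (v.erase i) = D at *
      generalize ((-1) ^ (u.erase i).card : F) = E at *
      have : A * C = E * B * D := by
        linear_combination (-A * B) * a1 - A * C * q2 + E * B * D * q1
      linear_combination (binom α β : F) * this
    · have k1 : (u ∪ v).erase i = u.erase i ∪ v := by grind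
      simp only [h1, h2, or_false, if_true, if_false, k1, map_smul, LinearMap.smul_apply,
        mul_mon, smul_smul, map_zero, add_zero]
      congr 1
      have a1 := eps_assoc F {i} (u.erase i) v
      have k2 : {i} ∪ u.erase i = u := by grind
      rw [k2] at a1
      have q1 := eps_sq F (u := {i}) (v := u.erase i) (by simp)
      have q2 := eps_sq F (u := {i}) (v := u.erase i ∪ v) (by simp [h2])
      generalize eps F {i} (u.erase i) = A at *
      generalize eps F {i} (u.erase i ∪ v) = B at *
      linear_combination (binom α β : F) * (A * B * a1 - B * eps F u v * q1
        + A * eps F (u.erase i) v * q2)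
    · have k1 : (u ∪ v).erase i = u ∪ v.erase i := by grind
      simp only [h1, h2, or_true, if_true, if_false, k1, map_smul, LinearMap.smul_apply,
        mul_mon, smul_smul, map_zero, LinearMap.zero_apply, zero_add]
      congr 1
      have a1 := eps_assoc F u {i} (v.erase i)
      have a2 := eps_assoc F {i} u (v.erase i)
      have k2 : {i} ∪ v.erase i = v := by grind
      rw [k2, eps_swap F u {i}, Finset.union_comm u {i}] at a1
      simp only [Finset.card_singleton, mul_one] at a1
      have q1 := eps_sq F (u := {i}) (v := v.erase i) (by simp)
      have q2 := eps_sq F (u := {i}) (v := u ∪ v.erase i) (by simp [h1])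
      generalize eps F {i} (v.erase i) = A at *
      generalize eps F {i} (u ∪ v.erase i) = B at *
      generalize ((-1) ^ u.card : F) = E at *
      linear_combination (binom α β : F) * (-A * B * a1 + A * B * E * a2 - B * eps F u v * q1
        + A * E * eps F u (v.erase i) * q2)
    · simp [h1, h2]

theorem pd_mul (r : Y n) (a b : OO F n) :
    pd F n r (mul F n a b) =
      mul F n (pd F n r a) b + mul F n ((sig F n ^ mu r) a) (pd F n r b) := by
  have h1 : pd F n r ∘ₗ (mul F n).flip b = (mul F n).flip b ∘ₗ pd F n r +
      (mul F n).flip (pd F n r b) ∘ₗ (sig F n ^ mu r) := by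
    refine hom_ext F fun α u => ?_
    have h2 : pd F n r ∘ₗ mul F n (mon F n α u) = mul F n (pd F n r (mon F n α u)) +
        mul F n ((sig F n ^ mu r) (mon F n α u)) ∘ₗ pd F n r := by
      refine hom_ext F fun β v => ?_
      exact pd_mul_mon F r α β u v
    exact congrArg (fun f => f b) h2
  exact congrArg (fun f => f a) h1

theorem pd_comm (r s : Y n) (a : OO F n) :
    pd F n r (pd F n s a) = ((-1) ^ (mu r * mu s) : F) • pd F n s (pd F n r a) := by
  have h1 : pd F n r ∘ₗ pd F n s = ((-1) ^ (mu r * mu s) : F) • (pd F n s ∘ₗ pd F n r) := by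
    refine hom_ext F fun α u => ?_
    simp only [LinearMap.comp_apply, LinearMap.smul_apply]
    rcases r with i | i <;> rcases s with j | j
    · simp only [pd_inl_mon, mu, mul_zero, pow_zero, one_smul]
      by_cases hij : i = j
      · subst hij; rfl
      · have k : α - Pi.single j 1 - Pi.single i 1 = α - Pi.single i 1 - Pi.single j 1 := by
          ext k; simp; omega
        by_cases h1 : α i = 0 <;> by_cases h2 : α j = 0 <;>
          simp [h1, h2, pd_inl_mon, Pi.single_eq_of_ne hij, Pi.single_eq_of_ne (Ne.symm hij), k]
    · by_cases h1 : α i = 0 <;> by_cases h2 : j ∈ u <;>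
        simp [h1, h2, pd_inl_mon, pd_inr_mon', mu]
    · by_cases h1 : α j = 0 <;> by_cases h2 : i ∈ u <;>
        simp [h1, h2, pd_inl_mon, pd_inr_mon', mu]
    · by_cases hij : i = j
      · subst hij; by_cases h1 : i ∈ u <;> simp [pd_inr_mon', h1]
      · by_cases h1 : i ∈ u <;> by_cases h2 : j ∈ u <;>
          simp only [pd_inr_mon', h1, h2, if_true, if_false, map_zero, smul_zero, map_smul,
            Finset.mem_erase, ne_eq, hij, Ne.symm hij, not_false_eq_true,
            and_false, and_true, mu, mul_one, pow_one, smul_smul]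
        rw [Finset.erase_right_comm]
        have k1 : {j} ∪ (u.erase i).erase j = u.erase i := by grind
        have k2 : {i} ∪ (u.erase i).erase j = u.erase j := by grind
        congr 1
        have a1 := eps_assoc F {i} {j} ((u.erase i).erase j)
        have a2 := eps_assoc F {j} {i} ((u.erase i).erase j)
        rw [k1, eps_swap F {i} {j}] at a1
        rw [k2, Finset.union_comm {j} {i}] at a2
        simp only [Finset.card_singleton, mul_one, pow_one] at a1
        linear_combination -a1 - a2
  exact congrArg (fun f => f a) h1


/-- A linear map sends the span of some standard basis elements into a given subspace if it does
so for these basis elements. -/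
theorem map_supported {M : Type*} [AddCommGroup M] [Module F M]
    {s : Set ((Fin n → ℕ) × Finset (Fin n))} {N : Submodule F M} (f : OO F n →ₗ[F] M)
    (h : ∀ α u, (α, u) ∈ s → f (mon F n α u) ∈ N) {a : OO F n}
    (ha : a ∈ Finsupp.supported F F s) : f a ∈ N := by
  rw [Finsupp.supported_eq_span_single] at ha
  have : Submodule.span F ((fun i => Finsupp.single i (1 : F)) '' s) ≤ N.comap f := by
    rw [Submodule.span_le]
    rintro _ ⟨⟨α, u⟩, hx, rfl⟩
    exact h α u hx
  exact this ha

theorem mon_mem {s : Set ((Fin n → ℕ) × Finset (Fin n))} {α : Fin n → ℕ} {u : Finset (Fin n)}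
    (h : (α, u) ∈ s) : mon F n α u ∈ Finsupp.supported F F s :=
  Finsupp.single_mem_supported F 1 h

theorem par_congr {θ φ : ℕ} (h : θ ≡ φ [MOD 2]) : par F n θ = par F n φ := by
  unfold par
  congr 1
  ext a
  exact ⟨fun k => k.trans h, fun k => k.trans h.symm⟩

theorem mul_par {θ φ : ℕ} {a b : OO F n} (ha : a ∈ par F n θ) (hb : b ∈ par F n φ) :
    mul F n a b ∈ par F n (θ + φ) := by
  refine map_supported F (N := par F n (θ + φ)) ((mul F n).flip b) (fun α u hu => ?_) ha
  refine map_supported F (N := par F n (θ + φ)) (mul F n (mon F n α u)) (fun β v hv => ?_) hb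
  rw [mul_mon]
  by_cases h : Disjoint u v
  · refine Submodule.smul_mem _ _ (mon_mem F ?_)
    simp only [Set.mem_ofPred_eq, Finset.card_union_of_disjoint h] at hu hv ⊢
    exact Nat.ModEq.add hu hv
  · simp [eps, h]

theorem pd_par (r : Y n) {θ : ℕ} {a : OO F n} (ha : a ∈ par F n θ) :
    pd F n r a ∈ par F n (θ + mu r) := by
  refine map_supported F (N := par F n (θ + mu r)) (pd F n r) (fun α u hu => ?_) ha
  rcases r with i | i
  · rw [pd_inl_mon]
    split_ifs
    · simp
    · exact mon_mem F hu
  · rw [pd_inr_mon]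
    split_ifs with h
    · refine Submodule.smul_mem _ _ (mon_mem F ?_)
      have := Finset.card_erase_add_one h
      simp only [Set.mem_ofPred_eq, mu, Nat.ModEq] at hu ⊢
      omega
    · simp

theorem sig_pow_par {θ : ℕ} (k : ℕ) {a : OO F n} (ha : a ∈ par F n θ) :
    (sig F n ^ k) a = ((-1) ^ (k * θ) : F) • a := by
  have := map_supported F (N := ⊥) (sig F n ^ k - ((-1) ^ (k * θ) : F) • LinearMap.id)
    (fun α u hu => ?_) ha
  · simpa [sub_eq_zero] using this
  · have e : ((-1) ^ (k * u.card) : F) = (-1) ^ (k * θ) := by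
      rw [mul_comm, mul_comm k, pow_mul, pow_mul]
      congr 1
      exact neg_one_pow_congr (by
        have : u.card % 2 = θ % 2 := hu
        rw [Nat.even_iff, Nat.even_iff, this])
    simp [sig_pow_mon, e]

theorem par_disjoint {a : OO F n} (h0 : a ∈ par F n 0) (h1 : a ∈ par F n 1) : a = 0 := by
  rw [par, Finsupp.mem_supported] at h0 h1
  rw [← Finsupp.support_eq_empty, Finset.eq_empty_iff_forall_notMem]
  intro x hx
  have e0 : x.2.card % 2 = 0 % 2 := h0 hx
  have e1 : x.2.card % 2 = 1 % 2 := h1 hx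
  omega

/-- Supercommutativity: `f g = (-1)^(p(f) p(g)) g f`. -/
theorem mul_comm_par {θ : ℕ} {a : OO F n} (ha : a ∈ par F n θ) (b : OO F n) :
    mul F n a ((sig F n ^ θ) b) = mul F n b a := by
  have := map_supported F (N := ⊥)
    ((mul F n).flip ((sig F n ^ θ) b) - mul F n b) (fun α u hu => ?_) ha
  · simpa [sub_eq_zero] using this
  have h : mul F n (mon F n α u) ∘ₗ (sig F n ^ θ) = (mul F n).flip (mon F n α u) := by
    refine hom_ext F fun β v => ?_
    have e : ((-1) ^ (u.card * v.card) : F) = (-1) ^ (θ * v.card) := by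
      rw [pow_mul, pow_mul]
      congr 1
      exact neg_one_pow_congr (by
        have : u.card % 2 = θ % 2 := hu
        rw [Nat.even_iff, Nat.even_iff, this])
    simp only [LinearMap.comp_apply, LinearMap.flip_apply, sig_pow_mon, map_smul, mul_mon,
      smul_smul, Finset.union_comm v u, add_comm β α, binom_comm β α]
    rw [eps_swap F v u, mul_comm v.card, e]
    congr 1
    ring
  have h' := congrArg (fun f => f b) h
  simp only [LinearMap.comp_apply, LinearMap.flip_apply] at h'
  simp [h']

theorem mul_comm_par' {θ φ : ℕ} {a b : OO F n} (ha : a ∈ par F n θ) (hb : b ∈ par F n φ) :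
    mul F n b a = ((-1) ^ (θ * φ) : F) • mul F n a b := by
  rw [← mul_comm_par F ha, sig_pow_par F θ hb, map_smul]

section truncated

variable (p : ℕ) (t : Fin n → ℕ)

theorem pd_OT (r : Y n) {a : OO F n} (ha : a ∈ OT F p t) : pd F n r a ∈ OT F p t := by
  refine map_supported F (N := OT F p t) (pd F n r) (fun α u hu => ?_) ha
  rcases r with i | i
  · rw [pd_inl_mon]
    split_ifs
    · simp
    · refine mon_mem F fun j => ?_
      exact lt_of_le_of_lt (by simp) (hu j)
  · rw [pd_inr_mon]
    split_ifs
    · exact Submodule.smul_mem _ _ (mon_mem F hu)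
    · simp

theorem sig_OT (k : ℕ) {a : OO F n} (ha : a ∈ OT F p t) : (sig F n ^ k) a ∈ OT F p t := by
  refine map_supported F (N := OT F p t) (sig F n ^ k) (fun α u hu => ?_) ha
  rw [sig_pow_mon]
  exact Submodule.smul_mem _ _ (mon_mem F hu)

theorem dvd_choose {p k a b : ℕ} (hp : p.Prime) (ha : a < p ^ k) (hb : b < p ^ k)
    (hab : p ^ k ≤ a + b) : p ∣ (a + b).choose a := by
  have h := hp.emultiplicity_choose' (n := b) (k := a)
    (b := max (Nat.log p (b + a) + 1) (k + 1)) (by omega)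
  rw [add_comm b a] at h
  rw [← emultiplicity_ne_zero, h]
  have hk : k ≠ 0 := by rintro rfl; simp at ha hb hab; omega
  have : ((Finset.Ico 1 (max (Nat.log p (a + b) + 1) (k + 1))).filter
      (fun i => p ^ i ≤ a % p ^ i + b % p ^ i)).card ≠ 0 := by
    rw [Finset.card_ne_zero]
    refine ⟨k, ?_⟩
    rw [Finset.mem_filter, Finset.mem_Ico, Nat.mod_eq_of_lt ha, Nat.mod_eq_of_lt hb]
    exact ⟨⟨by omega, by omega⟩, hab⟩
  exact_mod_cast this

variable [Fact p.Prime] [CharP F p]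

theorem mul_OT {a b : OO F n} (ha : a ∈ OT F p t) (hb : b ∈ OT F p t) :
    mul F n a b ∈ OT F p t := by
  refine map_supported F (N := OT F p t) ((mul F n).flip b) (fun α u hu => ?_) ha
  refine map_supported F (N := OT F p t) (mul F n (mon F n α u)) (fun β v hv => ?_) hb
  rw [mul_mon]
  by_cases h : ∀ i, α i + β i < p ^ t i
  · exact Submodule.smul_mem _ _ (mon_mem F h)
  · push Not at h
    obtain ⟨i, hi⟩ := h
    have h1 : p ∣ binom α β :=
      (dvd_choose Fact.out (hu i) (hv i) hi).trans (Finset.dvd_prod_of_mem _ (Finset.mem_univ i))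
    rw [(CharP.cast_eq_zero_iff F p _).2 h1]
    simp

end truncated

theorem mul_X_left (a : OO F n) : mul F n a (mon F n 0 ∅) = a := by
  have h : (mul F n).flip (mon F n 0 ∅) = LinearMap.id := by
    refine hom_ext F fun α u => ?_
    simp [mul_mon, binom, eps, inv]
  exact congrArg (fun f => f a) h

theorem pd_X (r s : Y n) : pd F n r (X F n s) = if r = s then mon F n 0 ∅ else 0 := by
  rcases r with i | i <;> rcases s with j | j
  · by_cases h : i = j
    · subst h; simp [X, pd_inl_mon]
    · simp [X, pd_inl_mon, h]
  · simp [X, pd_inl_mon]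
  · simp [X, pd_inr_mon]
  · by_cases h : i = j
    · subst h; simp [X, pd_inr_mon']; simp [eps, inv]
    · simp [X, pd_inr_mon, h]

/-- The coefficients of `∑ f_r ∂_r` are its values on the variables. -/
theorem vf_X (f : Y n → OO F n) (s : Y n) : vf F f (X F n s) = f s := by
  rw [vf_apply, Finset.sum_eq_single s]
  · rw [pd_X, if_pos rfl, mul_X_left]
  · intro r _ h; rw [pd_X, if_neg h, map_zero]
  · simp

theorem vf_injective : Function.Injective (vf F (n := n)) := fun f g h => by
  funext s; rw [← vf_X F f s, h, vf_X]

/-- An even `∑ f_r ∂_r` is a derivation. -/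
theorem vf_mul {f : Y n → OO F n} (hf : ∀ r, f r ∈ par F n (mu r)) (a b : OO F n) :
    vf F f (mul F n a b) = mul F n (vf F f a) b + mul F n a (vf F f b) := by
  simp only [vf_apply, map_sum, LinearMap.sum_apply, ← Finset.sum_add_distrib]
  refine Finset.sum_congr rfl fun r _ => ?_
  rw [pd_mul, map_add, ← mul_assoc', ← mul_assoc', ← mul_assoc', mul_comm_par F (hf r)]

/-- The commutator of two even elements `D = ∑ f_r ∂_r` and `E = ∑ g_r ∂_r` is
`∑ (D(g_s) - E(f_s)) ∂_s`. -/
theorem lie_vf {f g : Y n → OO F n} (hf : ∀ r, f r ∈ par F n (mu r))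
    (hg : ∀ r, g r ∈ par F n (mu r)) :
    vf F f * vf F g - vf F g * vf F f = vf F (fun s => vf F f (g s) - vf F g (f s)) := by
  have hsw : ∀ h : OO F n, ∑ s, mul F n (g s) (vf F f (pd F n s h)) =
      ∑ r, mul F n (f r) (vf F g (pd F n r h)) := by
    intro h
    simp only [vf_apply, map_sum]
    rw [Finset.sum_comm]
    refine Finset.sum_congr rfl fun r _ => Finset.sum_congr rfl fun s _ => ?_
    rw [← mul_assoc', ← mul_assoc', mul_comm_par' F (hf r) (hg s), pd_comm F r s h]
    simp only [map_smul, LinearMap.smul_apply, smul_smul]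
    rw [neg_one_pow_sq, one_smul]
  refine LinearMap.ext fun h => ?_
  rw [LinearMap.sub_apply, Module.End.mul_apply, Module.End.mul_apply]
  conv_lhs => rw [vf_apply F g h, vf_apply F f h]
  rw [map_sum, map_sum, vf_apply]
  simp only [vf_mul F hf, vf_mul F hg, map_sub, LinearMap.sub_apply, Finset.sum_add_distrib,
    Finset.sum_sub_distrib, hsw]
  abel


theorem vf_par {θ φ : ℕ} {f : Y n → OO F n} (hf : ∀ r, f r ∈ par F n (θ + mu r)) {a : OO F n}
    (ha : a ∈ par F n φ) : vf F f a ∈ par F n (θ + φ) := by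
  rw [vf_apply]
  refine Submodule.sum_mem _ fun r _ => ?_
  have h := mul_par F (hf r) (pd_par F r ha)
  rwa [par_congr F (φ := θ + φ)] at h
  simp only [Nat.ModEq]
  omega

/-- The coefficient of `∂_s` in `T_H(a)`. -/
noncomputable def thc (a : OO F n) (s : Y n) : OO F n := pd F n s.swap ((sig F n ^ mu s.swap) a)

theorem TH_eq_vf (a : OO F n) : TH F a = vf F (thc F a) := by
  refine LinearMap.ext fun h => ?_
  rw [TH_apply, vf_apply, ← (Equiv.sumComm (Fin n) (Fin n)).sum_comp]
  simp [thc]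

theorem thc_par {θ : ℕ} {a : OO F n} (ha : a ∈ par F n θ) (s : Y n) :
    thc F a s ∈ par F n (θ + 1 + mu s) := by
  unfold thc
  rw [sig_pow_par F _ ha, map_smul]
  have h := pd_par F s.swap ha
  rw [par_congr F (φ := θ + 1 + mu s)] at h
  · exact Submodule.smul_mem _ _ h
  · rcases s with i | i <;> simp only [Nat.ModEq, mu_inl, mu_inr, Sum.swap_inl, Sum.swap_inr] <;>
      omega

theorem thc_odd {a : OO F n} (ha : a ∈ par F n 1) (s : Y n) : thc F a s ∈ par F n (mu s) := by
  have h := thc_par F ha s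
  rwa [par_congr F (φ := mu s)] at h
  simp only [Nat.ModEq]
  omega

/-- `T_H(c)(b) = -T_H(b)(c)` for odd `b`. -/
theorem TH_skew {θ : ℕ} {b c : OO F n} (hb : b ∈ par F n 1) (hc : c ∈ par F n θ) :
    TH F c b = - TH F b c := by
  rw [TH_apply, TH_apply, ← (Equiv.sumComm (Fin n) (Fin n)).sum_comp, ← Finset.sum_neg_distrib]
  refine Finset.sum_congr rfl fun r _ => ?_
  have h := mul_comm_par' F (pd_par F r hb) (pd_par F r.swap hc)
  simp only [Equiv.sumComm_apply, Sum.swap_swap, sig_pow_par F _ hb, sig_pow_par F _ hc, map_smul,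
    LinearMap.smul_apply, h, smul_smul, ← neg_smul]
  congr 1
  rcases r with i | i
  · simp only [Sum.swap_inl, mu_inl, mu_inr]
    rw [← pow_add, show 1 * θ + (1 + 0) * (θ + 1) = 2 * θ + 1 by ring, pow_add, pow_mul]
    simp
  · simp only [Sum.swap_inr, mu_inl, mu_inr]
    rw [← pow_add, show 0 * θ + (1 + 1) * (θ + 0) = 2 * θ by ring, pow_mul]
    simp

/-- `∂_s (T_H(a)(b)) = T_H(∂_s a)(b) + T_H(a)(∂_s b)` for odd `a`. -/
theorem pd_TH (s : Y n) {a : OO F n} (ha : a ∈ par F n 1) (b : OO F n) :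
    pd F n s (TH F a b) = TH F (pd F n s a) b + TH F a (pd F n s b) := by
  simp only [TH_apply, map_sum, ← Finset.sum_add_distrib]
  refine Finset.sum_congr rfl fun r _ => ?_
  have hsa := pd_par F s ha
  have hra := pd_par F r ha
  rw [pd_mul]
  simp only [sig_pow_par F _ ha, sig_pow_par F _ hsa, map_smul, LinearMap.smul_apply,
    sig_pow_par F _ hra]
  rw [pd_comm F s r a, pd_comm F s r.swap b]
  simp only [map_smul, LinearMap.smul_apply, smul_smul]
  congr 2
  · simp only [← pow_add]
    exact neg_one_pow_congr (by
      rcases r with i | i <;> rcases s with j | j <;> simp)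
  · simp only [← pow_add]
    exact neg_one_pow_congr (by
      rcases r with i | i <;> rcases s with j | j <;> simp <;> decide)

/-- `[T_H(a), T_H(b)] = T_H(T_H(a)(b))` for odd `a` and `b`. -/
theorem lie_TH {a b : OO F n} (ha : a ∈ par F n 1) (hb : b ∈ par F n 1) :
    TH F a * TH F b - TH F b * TH F a = TH F (TH F a b) := by
  have hab : TH F a b ∈ par F n 1 := by
    rw [TH_eq_vf]
    have := vf_par F (θ := 0) (fun r => by simpa using thc_odd F ha r) hb
    simpa using this
  have hE : ∀ s, TH F b (pd F n s a) = - TH F (pd F n s a) b := fun s => by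
    rw [TH_skew F hb (pd_par F s ha), neg_neg]
  rw [TH_eq_vf F a, TH_eq_vf F b, lie_vf F (thc_odd F ha) (thc_odd F hb), ← TH_eq_vf F a,
    ← TH_eq_vf F b, TH_eq_vf F (TH F a b)]
  congr 1
  funext s
  simp only [thc, sig_pow_par F _ ha, sig_pow_par F _ hb, sig_pow_par F _ hab, map_smul, ← smul_sub,
    hE, sub_neg_eq_add, pd_TH F _ ha]
  rw [add_comm]

section truncated

variable (p : ℕ) (t : Fin n → ℕ)

/-- An even element of the form `T_H(a)` is `T_H` of an odd element. -/
theorem exists_odd {a : OO F n} (ha : a ∈ OT F p t) (h : TH F a ∈ Wpar F p t 0) :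
    ∃ b ∈ OT F p t ⊓ par F n 1, TH F b = TH F a := by
  classical
  obtain ⟨f, hf, hfa⟩ := h
  rw [TH_eq_vf] at hfa
  have hfa := vf_injective F hfa
  set a0 := a.filter (fun x => x.2.card % 2 = 0) with h0
  set a1 := a.filter (fun x => ¬ x.2.card % 2 = 0) with h1
  have hsum : a0 + a1 = a := Finsupp.filter_add_filter_not a _
  have p0 : a0 ∈ par F n 0 := by
    rw [par, Finsupp.mem_supported]
    intro x hx
    simp only [h0, Finsupp.support_filter, Finset.coe_filter, Set.mem_ofPred_eq] at hx
    exact hx.2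
  have p1 : a1 ∈ par F n 1 := by
    rw [par, Finsupp.mem_supported]
    intro x hx
    simp only [h1, Finsupp.support_filter, Finset.coe_filter, Set.mem_ofPred_eq] at hx
    simp only [Set.mem_ofPred_eq, Nat.ModEq]
    omega
  have q1 : a1 ∈ OT F p t := by
    rw [OT, Finsupp.mem_supported] at ha ⊢
    intro x hx
    simp only [h1, Finsupp.support_filter, Finset.coe_filter, Set.mem_ofPred_eq] at hx
    exact ha (by simpa using hx.1)
  refine ⟨a1, ⟨q1, p1⟩, ?_⟩
  have hz : thc F a0 = 0 := by
    funext s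
    have e1 : thc F a0 s = f s - thc F a1 s := by
      rw [hfa, ← hsum]; simp [thc]
    have e2 : thc F a0 s ∈ par F n (mu s) := by
      rw [e1]
      exact Submodule.sub_mem _ (by simpa using (hf s trivial).2) (thc_odd F p1 s)
    have e3 := thc_par F p0 s
    rcases s with i | i
    · exact par_disjoint F e2 e3
    · rw [par_congr F (φ := 0) (by simp [Nat.ModEq])] at e3
      exact par_disjoint F e3 e2
  rw [← hsum, map_add, TH_eq_vf F a0, hz, map_zero, zero_add]

variable [Fact p.Prime] [CharP F p]

theorem vf_OT {f : Y n → OO F n} (hf : ∀ r, f r ∈ OT F p t) {a : OO F n} (ha : a ∈ OT F p t) :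
    vf F f a ∈ OT F p t := by
  rw [vf_apply]
  exact Submodule.sum_mem _ fun r _ => mul_OT F p t (hf r) (pd_OT F p t r ha)

/-- The commutator bracket on the operators on `𝒪(n, n)`. -/
noncomputable instance : LieRing (Module.End F (OO F n)) := LieRing.ofAssociativeRing

noncomputable instance : LieAlgebra F (Module.End F (OO F n)) := LieAlgebra.ofAssociativeAlgebra

/-- The Lie algebra `𝒲`: the even part of `W(n, n; t)`. On even elements the bracket of the Lie
superalgebra `W(n, n; t)` is the commutator of operators on `𝒪(n, n)`. -/
noncomputable def WW : LieSubalgebra F (Module.End F (OO F n)) :=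
  { Wpar F p t 0 with
    lie_mem' := by
      rintro _ _ ⟨f, hf, rfl⟩ ⟨g, hg, rfl⟩
      have hf' : ∀ r, f r ∈ par F n (mu r) := fun r => by simpa using (hf r trivial).2
      have hg' : ∀ r, g r ∈ par F n (mu r) := fun r => by simpa using (hg r trivial).2
      rw [LieRing.of_associative_ring_bracket, lie_vf F hf' hg']
      refine ⟨_, fun s _ => ⟨?_, ?_⟩, rfl⟩
      · exact Submodule.sub_mem _ (vf_OT F p t (fun r => (hf r trivial).1) (hg s trivial).1)
          (vf_OT F p t (fun r => (hg r trivial).1) (hf s trivial).1)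
      · exact Submodule.sub_mem _ (vf_par F (fun r => (hf r trivial).2) (hg' s))
          (vf_par F (fun r => (hg r trivial).2) (hf' s)) }

/-- The component `𝒲_k = 𝒲 ∩ {∑ f_r ∂_r | f_r ∈ 𝒪(n, n; t)_(k+1)}` of the `ℤ`-gradation. -/
noncomputable def Wdeg (k : ℤ) : Submodule F (WW F p t) :=
  ((Submodule.pi Set.univ fun _ => OTdeg F p t (k + 1)).map (vf F)).comap
    (WW F p t).toSubmodule.subtype

/-- The Lie algebra `ℋ𝒪`: the even part `HO(n, n; t) ∩ 𝒲` of the odd Hamiltonian superalgebra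
`HO(n, n; t) = {T_H(a) | a ∈ 𝒪(n, n; t)}`. -/
noncomputable def HO : LieSubalgebra F (WW F p t) :=
  { ((OT F p t).map (TH F)).comap (WW F p t).toSubmodule.subtype with
    lie_mem' := by
      rintro ⟨x, hx⟩ ⟨y, hy⟩ ⟨a, ha, hax⟩ ⟨b, hb, hby⟩
      simp only [Submodule.subtype_apply] at hax hby
      subst hax hby
      obtain ⟨a', ⟨ha1, ha2⟩, ha'⟩ := exists_odd F p t ha hx
      obtain ⟨b', ⟨hb1, hb2⟩, hb'⟩ := exists_odd F p t hb hy
      refine ⟨TH F a' b', ?_, ?_⟩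
      · rw [TH_eq_vf]
        exact vf_OT F p t (fun r => pd_OT F p t _ (sig_OT F p t _ ha1)) hb1
      · rw [← lie_TH F ha2 hb2, ha', hb']; rfl }

/-- The component `ℋ𝒪_k = ℋ𝒪 ∩ 𝒲_k` of the `ℤ`-gradation. -/
noncomputable def HOdeg (k : ℤ) : Submodule F (HO F p t) :=
  (Wdeg F p t k).comap (HO F p t).toSubmodule.subtype

/-- The space `Der_k(ℋ𝒪)` of the derivations of `ℋ𝒪` that map `ℋ𝒪_i` into `ℋ𝒪_(k+i)` for all
`i ∈ ℤ`. -/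
noncomputable def DerDeg (k : ℤ) : Submodule F (LieDerivation F (HO F p t) (HO F p t)) where
  carrier := {φ | ∀ i : ℤ, ∀ x ∈ HOdeg F p t i, φ x ∈ HOdeg F p t (k + i)}
  zero_mem' := fun _ _ _ => Submodule.zero_mem _
  add_mem' := fun hφ hψ i x hx => Submodule.add_mem _ (hφ i x hx) (hψ i x hx)
  smul_mem' := fun c _ hφ i x hx => Submodule.smul_mem _ c (hφ i x hx)

/-- The operator `Γ = ∑ x_{i'} ∂_{i'}`, an element of `𝒲`. -/
noncomputable def Gam : WW F p t :=
  ⟨vf F (Sum.elim 0 fun i => X F n (Sum.inr i)), _, by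
    rintro (i | i) -
    · exact Submodule.zero_mem _
    · exact ⟨mon_mem F fun j => pow_pos (Fact.out : p.Prime).pos _,
        mon_mem F (by simp [mu, Nat.ModEq])⟩, rfl⟩

/-- The subspace `ℋ𝒪 + F Γ` of `𝒲`. -/
noncomputable def HOGam : Submodule F (WW F p t) :=
  (HO F p t).toSubmodule ⊔ Submodule.span F {Gam F p t}

/-- A derivation of `ℋ𝒪`, viewed as a linear map from `ℋ𝒪` to `𝒲`. -/
noncomputable def derIncl :
    LieDerivation F (HO F p t) (HO F p t) →ₗ[F] (HO F p t →ₗ[F] WW F p t) where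
  toFun φ := (HO F p t).toSubmodule.subtype ∘ₗ φ.toLinearMap
  map_add' _ _ := rfl
  map_smul' _ _ := rfl

/-- The map `E ↦ ad E|_{ℋ𝒪}`, `(ad E)(x) = [E, x]`, for `E ∈ 𝒲`. -/
noncomputable def adHO : WW F p t →ₗ[F] (HO F p t →ₗ[F] WW F p t) where
  toFun E :=
    { toFun := fun x => ⁅E, (x : WW F p t)⁆
      map_add' := fun x y => lie_add E (x : WW F p t) (y : WW F p t)
      map_smul' := fun c x => lie_smul c E (x : WW F p t) }
  map_add' D E := LinearMap.ext fun x => add_lie D E (x : WW F p t)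
  map_smul' c E := LinearMap.ext fun x => smul_lie c E (x : WW F p t)

theorem derIncl_apply (φ : LieDerivation F (HO F p t) (HO F p t)) (x : HO F p t) :
    derIncl F p t φ x = (φ x : WW F p t) := rfl

theorem adHO_apply (E : WW F p t) (x : HO F p t) : adHO F p t E x = ⁅E, (x : WW F p t)⁆ := rfl

end truncated

end OddHamiltonian

/-!
Up to constants, `T_H` identifies `ℋ𝒪` with the odd part of the superalgebra `𝒪`, the Lie bracket
becoming `(a, b) ↦ T_H(a)(b)`, so that a derivation of `ℋ𝒪` is a linear map `D` on odd elements.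
Let its degree be `k ≥ 0`. Inner corrections make `D` vanish on all `x_{i'}`: because
`T_H(x_{i'}) = -∂_i`, the `D(x_{i'})` have symmetric derivatives in the even variables, and divided
powers can be integrated. Now `D` commutes with every `∂_i`, and a further correction makes it
vanish on the commuting elements `x_i x_{i'}`, whose adjoint action is diagonal on monomials. Hence
`D` preserves weights; for `p > 2`, the weights and the degree force it to multiply each monomial
`x^{(α)} x^u` by a scalar which, thanks to the `∂_i`, depends on `u` only. The bracket of monomials
makes this scalar additive along `|u| - 1`, so it is `κ (|u| - 1)`, and `D` is `κ • ad Γ`;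
for `k > 0` the degree gives `D = 0`. The normalizer follows because only multiples of `Γ` in `𝒲`
centralize `ℋ𝒪`.
-/

namespace OddHamiltonian

section OddSets

variable {ι : Type*} [DecidableEq ι]

theorem eq_of_card_eq_of_exchange {β : Type*} {c : Finset ι → β} {m : ℕ}
    (h : ∀ {v : Finset ι} {i j : ι}, v.card = m → i ∈ v → j ∉ v → c (insert j (v.erase i)) = c v)
    {v w : Finset ι} (hv : v.card = m) (hw : w.card = m) : c v = c w := by
  induction hl : (v \ w).card generalizing v with
  | zero =>
    rw [Finset.card_eq_zero, Finset.sdiff_eq_empty_iff_subset] at hl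
    rw [Finset.eq_of_subset_of_card_le hl (by omega)]
  | succ l ih =>
    obtain ⟨i, hi⟩ := Finset.card_pos.1 (show 0 < (v \ w).card by omega)
    obtain ⟨j, hj⟩ := Finset.card_pos.1 (show 0 < (w \ v).card by
      have := Finset.card_sdiff_comm (hv.trans hw.symm)
      omega)
    rw [Finset.mem_sdiff] at hi hj
    rw [← h hv hi.1 hj.2]
    refine ih ?_ ?_
    · rw [Finset.card_insert_of_notMem (by simp [hj.2]), Finset.card_erase_add_one hi.1, hv]
    · rw [Finset.insert_sdiff_of_mem _ hj.1, Finset.erase_sdiff_comm,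
        Finset.card_erase_of_mem (by simp [hi]), hl, Nat.add_sub_cancel]

theorem exists_eq_mul_card_sub_one {K : Type*} [Field K] (h2 : (2 : K) ≠ 0) {c : Finset ι → K}
    (h1 : ∀ i, c {i} = 0)
    (hadd : ∀ {i v w}, v.card ≡ 1 [MOD 2] → w.card ≡ 1 [MOD 2] → i ∈ w →
      Disjoint v (w.erase i) → c (v ∪ w.erase i) = c v + c w) :
    ∃ κ, ∀ v, v.card ≡ 1 [MOD 2] → c v = κ * (v.card - 1) := by
  have hswap {v : Finset ι} {i j : ι} (hv : v.card = 3) (hi : i ∈ v) (hj : j ∉ v) :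
      c (insert j (v.erase i)) = c v := by
    rw [← Finset.singleton_union, hadd (v := {j}) rfl (hv ▸ rfl) hi (by simp [hj]), h1,
      zero_add]
  obtain ⟨κ, hκ⟩ : ∃ κ, ∀ w : Finset ι, w.card = 3 → c w = 2 * κ := by
    by_cases h : ∃ w : Finset ι, w.card = 3
    · obtain ⟨w, hw⟩ := h
      exact ⟨c w / 2, fun v hv => by
        rw [mul_div_cancel₀ _ h2, eq_of_card_eq_of_exchange hswap hv hw]⟩
    · exact ⟨0, fun w hw => absurd ⟨w, hw⟩ h⟩
  refine ⟨κ, fun v => ?_⟩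
  induction v using Finset.strongInduction with
  | H v ih =>
  intro hv
  by_cases hv1 : v.card = 1
  · obtain ⟨i, rfl⟩ := Finset.card_eq_one.1 hv1
    simp [h1]
  · obtain ⟨w, hwv, hw⟩ := Finset.exists_subset_card_eq (s := v) (n := 3)
      (by unfold Nat.ModEq at hv; omega)
    obtain ⟨i, hi⟩ := Finset.card_pos.1 (show 0 < w.card by omega)
    have hsub : w.erase i ⊆ v := (w.erase_subset i).trans hwv
    have hcard : (v \ w.erase i).card + 2 = v.card := by
      rw [← Finset.card_sdiff_add_card_eq_card hsub, Finset.card_erase_of_mem hi, hw]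
    have hodd : (v \ w.erase i).card ≡ 1 [MOD 2] := by unfold Nat.ModEq at hv ⊢; omega
    have hlt : v \ w.erase i ⊂ v :=
      Finset.sdiff_subset.ssubset_of_ne fun h => by rw [h] at hcard; omega
    rw [← Finset.sdiff_union_of_subset hsub, hadd hodd (hw ▸ rfl) hi Finset.sdiff_disjoint,
      ih _ hlt hodd, hκ w hw, Finset.sdiff_union_of_subset hsub, ← hcard]
    push_cast
    ring

end OddSets

/-- On the common zeros of the `w i` the hypotheses leave `b` free; elsewhere `b = g i / w i` for
any `i` with `w i ≠ 0`. -/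
theorem exists_finsupp_eq_mul {ι σ K : Type*} [Finite ι] [Field K] {w : ι → σ → K}
    {g : ι → σ →₀ K} (hgw : ∀ i j x, w i x * g j x = w j x * g i x)
    (hg : ∀ i x, g i x ≠ 0 → ∃ j, w j x ≠ 0) :
    ∃ b : σ →₀ K, (∀ i x, g i x = w i x * b x) ∧ ∀ x, b x ≠ 0 → ∃ i, g i x ≠ 0 := by
  classical
  let β (x : σ) : K := if h : ∃ i, w i x ≠ 0 then g h.choose x / w h.choose x else 0
  have hβ (x : σ) (hx : β x ≠ 0) : ∃ i, g i x ≠ 0 := by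
    by_cases h : ∃ i, w i x ≠ 0
    · simp only [β, dif_pos h] at hx
      exact ⟨_, (div_ne_zero_iff.1 hx).1⟩
    · exact absurd (dif_neg h) hx
  have hfin : β.support.Finite :=
    (Set.finite_iUnion fun i => (g i).support.finite_toSet).subset fun x hx => by
      simpa using hβ x hx
  refine ⟨Finsupp.ofSupportFinite β hfin, fun i x => ?_, hβ⟩
  rw [Finsupp.ofSupportFinite_coe]
  by_cases h : ∃ j, w j x ≠ 0
  · simp only [β, dif_pos h]
    rw [← mul_div_assoc, hgw, mul_div_cancel_left₀ _ h.choose_spec]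
  · rw [not_imp_comm.1 (hg i x) h, of_not_not (not_exists.1 h i), zero_mul]

section NormalizerAd

variable {R L : Type*} [CommRing R] [LieRing L] [LieAlgebra R L] {K : LieSubalgebra R L}

/-- The derivation `x ↦ ⁅E, x⁆` of a Lie subalgebra defined by an element `E` of its
normalizer. -/
def normalizerAd (E : L) (hE : E ∈ K.normalizer) : LieDerivation R K K where
  toFun x := ⟨⁅E, (x : L)⁆, (K.mem_normalizer_iff E).1 hE x x.2⟩
  map_add' x y := Subtype.ext (lie_add E (x : L) y)
  map_smul' c x := Subtype.ext (lie_smul c E (x : L))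
  leibniz' x y := Subtype.ext <| by
    change ⁅E, ⁅(x : L), (y : L)⁆⁆ = ⁅(x : L), ⁅E, (y : L)⁆⁆ - ⁅(y : L), ⁅E, (x : L)⁆⁆
    rw [leibniz_lie E, ← lie_skew (y : L)]
    abel

end NormalizerAd

theorem sub_single_add_single {ι : Type*} [DecidableEq ι] {α : ι → ℕ} {i : ι} (h : α i ≠ 0) :
    α - Pi.single i 1 + Pi.single i 1 = α :=
  tsub_add_cancel_of_le <| update_le_iff.2 ⟨Nat.one_le_iff_ne_zero.2 h, fun _ _ => Nat.zero_le _⟩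

theorem sub_single_lt {ι : Type*} [DecidableEq ι] {α : ι → ℕ} {i : ι} (h : α i ≠ 0) :
    α - Pi.single i 1 < α := by
  conv_rhs => rw [← sub_single_add_single h]
  exact lt_add_of_pos_right _ (by simp)

theorem eq_add_single_iff {ι : Type*} [DecidableEq ι] {α β : ι → ℕ} {i : ι} :
    β = α + Pi.single i 1 ↔ β i ≠ 0 ∧ β - Pi.single i 1 = α := by
  refine ⟨?_, fun h => by rw [← h.2, sub_single_add_single h.1]⟩
  rintro rfl
  simp

theorem sum_sub_single_add_one {ι : Type*} [Fintype ι] [DecidableEq ι] {α : ι → ℕ} {i : ι}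
    (h : α i ≠ 0) : ∑ j, (α - Pi.single i 1 : ι → ℕ) j + 1 = ∑ j, α j := by
  conv_rhs => rw [← sub_single_add_single h]
  simp only [Pi.add_apply, Finset.sum_add_distrib, Finset.sum_pi_single', Finset.mem_univ, if_true]

variable {F : Type*} [Field F] {n p : ℕ} {t : Fin n → ℕ}

theorem mon_apply (α : Fin n → ℕ) (u : Finset (Fin n)) (x : (Fin n → ℕ) × Finset (Fin n)) :
    mon F n α u x = if (α, u) = x then 1 else 0 :=
  Finsupp.single_apply

theorem eps_empty_left (u : Finset (Fin n)) : eps F ∅ u = 1 := by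
  simp [eps, inv]

theorem eps_ne_zero {u v : Finset (Fin n)} (h : Disjoint u v) : eps F u v ≠ 0 := by
  simp [eps, h]

theorem binom_single_left (i : Fin n) (α : Fin n → ℕ) : binom (Pi.single i 1) α = α i + 1 := by
  rw [binom, Finset.prod_eq_single i (fun j _ hj => by simp [hj]) (by simp)]
  simp [add_comm]

theorem X_inl_mul_mon (i : Fin n) (α : Fin n → ℕ) (u : Finset (Fin n)) :
    mul F n (X F n (Sum.inl i)) (mon F n α u) = (α i + 1 : F) • mon F n (α + Pi.single i 1) u := by
  simp [X, mul_mon, binom_single_left, eps_empty_left, add_comm]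

theorem X_inr_mul_mon (i : Fin n) (α : Fin n → ℕ) (u : Finset (Fin n)) :
    mul F n (X F n (Sum.inr i)) (mon F n α u) = eps F {i} u • mon F n α (insert i u) := by
  simp [X, mul_mon, binom]

theorem pd_inl_apply (i : Fin n) (a : OO F n) (α : Fin n → ℕ) (u : Finset (Fin n)) :
    pd F n (Sum.inl i) a (α, u) = a (α + Pi.single i 1, u) := by
  have h : Finsupp.lapply (α, u) ∘ₗ pd F n (Sum.inl i) =
      Finsupp.lapply (α + Pi.single i 1, u) := hom_ext F fun β v => by
    by_cases hβ : β i = 0 <;> simp [pd_inl_mon, mon_apply, eq_add_single_iff, hβ]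
  exact LinearMap.congr_fun h a

theorem pd_inr_apply (i : Fin n) (a : OO F n) (α : Fin n → ℕ) (u : Finset (Fin n)) :
    pd F n (Sum.inr i) a (α, u) = if i ∈ u then 0 else eps F {i} u * a (α, insert i u) := by
  have h : Finsupp.lapply (α, u) ∘ₗ pd F n (Sum.inr i) =
      (if i ∈ u then 0 else eps F {i} u) • Finsupp.lapply (α, insert i u) :=
    hom_ext F fun β v => by
      have hu : i ∈ v → i ∉ u → (v.erase i = u ↔ v = insert i u) := by grind
      have hu' : i ∈ u → v.erase i ≠ u := by grind
      have hu'' : i ∉ v → v ≠ insert i u := by grind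
      simp only [LinearMap.comp_apply, LinearMap.smul_apply, pd_inr_mon', Finsupp.lapply_apply]
      by_cases hiv : i ∈ v <;> by_cases hiu : i ∈ u
      · simp [mon_apply, hiv, hiu, hu' hiu]
      · by_cases e : v = insert i u
        · simp [mon_apply, e, hiu]
        · simp [mon_apply, hiv, hiu, hu hiv hiu, e]
      · simp [hiv, hiu]
      · simp [mon_apply, hiv, hu'' hiv]
  have := LinearMap.congr_fun h a
  simp only [LinearMap.comp_apply, LinearMap.smul_apply, Finsupp.lapply_apply, smul_eq_mul,
    ite_mul, zero_mul] at this
  exact this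

theorem X_inl_mul_apply (i : Fin n) (a : OO F n) (α : Fin n → ℕ) (u : Finset (Fin n)) :
    mul F n (X F n (Sum.inl i)) a (α, u) = α i * a (α - Pi.single i 1, u) := by
  have h : Finsupp.lapply (α, u) ∘ₗ mul F n (X F n (Sum.inl i)) =
      (α i : F) • Finsupp.lapply (α - Pi.single i 1, u) := hom_ext F fun β v => by
    by_cases e : β + Pi.single i 1 = α
    · subst e
      simp [X_inl_mul_mon, mon_apply]
    · have : α i = 0 ∨ β ≠ α - Pi.single i 1 := by
        by_contra! h
        exact e (by rw [h.2, sub_single_add_single h.1])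
      rcases this with h | h <;> simp [X_inl_mul_mon, mon_apply, e, h]
  exact LinearMap.congr_fun h a

theorem X_inr_mul_apply (i : Fin n) (a : OO F n) (α : Fin n → ℕ) (u : Finset (Fin n)) :
    mul F n (X F n (Sum.inr i)) a (α, u) =
      if i ∈ u then eps F {i} (u.erase i) * a (α, u.erase i) else 0 := by
  have h : Finsupp.lapply (α, u) ∘ₗ mul F n (X F n (Sum.inr i)) =
      (if i ∈ u then eps F {i} (u.erase i) else 0) • Finsupp.lapply (α, u.erase i) :=
    hom_ext F fun β v => by
      have hv : i ∉ v → (insert i v = u ↔ i ∈ u ∧ v = u.erase i) := by grind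
      simp only [LinearMap.comp_apply, LinearMap.smul_apply, X_inr_mul_mon, Finsupp.lapply_apply,
        map_smul, smul_eq_mul, mon_apply, Prod.mk.injEq]
      by_cases hiv : i ∈ v
      · have : v ≠ u.erase i := by grind
        simp [eps, hiv, this]
      · by_cases hiu : i ∈ u <;> by_cases e : v = u.erase i <;> simp_all
  have := LinearMap.congr_fun h a
  simp only [LinearMap.comp_apply, LinearMap.smul_apply, Finsupp.lapply_apply, smul_eq_mul,
    ite_mul, zero_mul] at this
  exact this

theorem X_inr_mul_pd_inr_apply (i : Fin n) (a : OO F n) (α : Fin n → ℕ) (u : Finset (Fin n)) :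
    mul F n (X F n (Sum.inr i)) (pd F n (Sum.inr i) a) (α, u) = if i ∈ u then a (α, u) else 0 := by
  rw [X_inr_mul_apply, pd_inr_apply, if_neg (u.notMem_erase i)]
  split_ifs with h
  · rw [← mul_assoc, eps_sq F (by simp), one_mul, Finset.insert_erase h]
  · rfl

theorem apply_eq_pd_inl_apply {i : Fin n} {α : Fin n → ℕ} (h : α i ≠ 0) (a : OO F n)
    (u : Finset (Fin n)) : a (α, u) = pd F n (Sum.inl i) a (α - Pi.single i 1, u) := by
  rw [pd_inl_apply, sub_single_add_single h]

theorem exists_pd_apply_ne_zero {a : OO F n} {α : Fin n → ℕ} {u : Finset (Fin n)}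
    (ha : a (α, u) ≠ 0) (h : α ≠ 0 ∨ u ≠ ∅) :
    ∃ r β v, pd F n r a (β, v) ≠ 0 ∧ ∑ i, β i + v.card + 1 = ∑ i, α i + u.card := by
  by_cases hα : α = 0
  · obtain ⟨i, hi⟩ := Finset.nonempty_iff_ne_empty.2 (h.resolve_left (not_not.2 hα))
    refine ⟨Sum.inr i, α, u.erase i, ?_, ?_⟩
    · rw [pd_inr_apply, if_neg (u.notMem_erase i), Finset.insert_erase hi]
      exact mul_ne_zero (eps_ne_zero (by simp)) ha
    · rw [add_assoc, Finset.card_erase_add_one hi]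
  · obtain ⟨i, hi⟩ := Function.ne_iff.1 hα
    refine ⟨Sum.inl i, α - Pi.single i 1, u, by rwa [← apply_eq_pd_inl_apply hi], ?_⟩
    rw [← sum_sub_single_add_one hi]
    ring

theorem eq_zero_of_pd_eq_zero {a : OO F n} (h : ∀ r, pd F n r a = 0) (h₀ : a (0, ∅) = 0) :
    a = 0 := by
  ext ⟨α, u⟩
  by_contra ha
  have hne : α ≠ 0 ∨ u ≠ ∅ := by
    by_contra! e
    exact ha (by rw [e.1, e.2, h₀, Finsupp.zero_apply])
  obtain ⟨r, β, v, hr, -⟩ := exists_pd_apply_ne_zero ha hne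
  exact hr (by rw [h r, Finsupp.zero_apply])

section Homog

variable (F) in
/-- The component of total degree `m` of `𝒪(n, n)`, for the grading in which every variable has
degree one; `OTdeg F p t m` is its intersection with the truncated algebra. -/
noncomputable def homog (m : ℤ) : Submodule F (OO F n) :=
  Finsupp.supported F F {x | ((∑ i, x.1 i + x.2.card : ℕ) : ℤ) = m}

theorem mem_homog {m : ℤ} {a : OO F n} :
    a ∈ homog F m ↔ ∀ α u, a (α, u) ≠ 0 → ((∑ i, α i + u.card : ℕ) : ℤ) = m := by
  simp only [homog, Finsupp.mem_supported', not_imp_comm, Prod.forall, Set.mem_ofPred_eq]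

theorem OTdeg_eq (p : ℕ) (t : Fin n → ℕ) (m : ℤ) : OTdeg F p t m = OT F p t ⊓ homog F m :=
  Finsupp.supported_inter _ _

theorem homog_of_pd {a : OO F n} {m : ℤ} (h : ∀ r, pd F n r a ∈ homog F m)
    (h₀ : a (0, ∅) = 0) : a ∈ homog F (m + 1) := by
  rw [mem_homog]
  intro α u ha
  have hne : α ≠ 0 ∨ u ≠ ∅ := by
    by_contra! e
    exact ha (by rw [e.1, e.2, h₀])
  obtain ⟨r, β, v, hr, hdeg⟩ := exists_pd_apply_ne_zero ha hne
  have := mem_homog.1 (h r) β v hr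
  omega

theorem pd_homog (r : Y n) {m : ℤ} {a : OO F n} (ha : a ∈ homog F m) :
    pd F n r a ∈ homog F (m - 1) := by
  rw [mem_homog] at ha ⊢
  intro α u h
  rcases r with i | i
  · rw [pd_inl_apply] at h
    have := ha _ _ h
    simp only [Pi.add_apply, Finset.sum_add_distrib, Finset.sum_pi_single', Finset.mem_univ,
      if_true] at this
    omega
  · rw [pd_inr_apply] at h
    split_ifs at h with hi
    · exact absurd rfl h
    · have := ha _ _ (right_ne_zero_of_mul h)
      rw [Finset.card_insert_of_notMem hi] at this
      omega

theorem sig_pow_homog (k : ℕ) {m : ℤ} {a : OO F n} (ha : a ∈ homog F m) :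
    (sig F n ^ k) a ∈ homog F m := by
  refine map_supported F (N := homog F m) (sig F n ^ k) (fun α u hu => ?_) ha
  rw [sig_pow_mon]
  exact Submodule.smul_mem _ _ (mon_mem F hu)

theorem mul_homog {l m : ℤ} {a b : OO F n} (ha : a ∈ homog F l) (hb : b ∈ homog F m) :
    mul F n a b ∈ homog F (l + m) := by
  refine map_supported F (N := homog F (l + m)) ((mul F n).flip b) (fun α u hu => ?_) ha
  refine map_supported F (N := homog F (l + m)) (mul F n (mon F n α u)) (fun β v hv => ?_) hb
  rw [mul_mon]
  by_cases h : Disjoint u v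
  · refine Submodule.smul_mem _ _ (mon_mem F ?_)
    simp only [Set.mem_ofPred_eq, Finset.card_union_of_disjoint h, Pi.add_apply,
      Finset.sum_add_distrib] at hu hv ⊢
    omega
  · simp [eps, h]

theorem vf_homog {l m : ℤ} {f : Y n → OO F n} (hf : ∀ r, f r ∈ homog F l) {a : OO F n}
    (ha : a ∈ homog F m) : vf F f a ∈ homog F (l + (m - 1)) := by
  rw [vf_apply]
  exact Submodule.sum_mem _ fun r _ => mul_homog (hf r) (pd_homog r ha)

theorem thc_homog {m : ℤ} {a : OO F n} (ha : a ∈ homog F m) (s : Y n) :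
    thc F a s ∈ homog F (m - 1) :=
  pd_homog _ (sig_pow_homog _ ha)

theorem TH_homog {l m : ℤ} {a b : OO F n} (ha : a ∈ homog F l) (hb : b ∈ homog F m) :
    TH F a b ∈ homog F (l + m - 2) := by
  rw [TH_eq_vf, show l + m - 2 = l - 1 + (m - 1) by ring]
  exact vf_homog (thc_homog ha) hb

theorem mon_mem_homog {α : Fin n → ℕ} {u : Finset (Fin n)} {m : ℤ}
    (h : ((∑ i, α i + u.card : ℕ) : ℤ) = m) : mon F n α u ∈ homog F m :=
  mon_mem F h

theorem X_mem_homog (r : Y n) : X F n r ∈ homog F 1 := by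
  rcases r with i | i <;> exact mon_mem_homog (by simp)

end Homog

section LowDegree

variable (F) in
/-- The quadratic element `x_i x_{j'}` of `𝒪(n, n)`. The operators `T_H(x_i x_{i'})` span the
standard torus of `ℋ𝒪`. -/
noncomputable def quad (i j : Fin n) : OO F n := mon F n (Pi.single i 1) {j}

variable (F) in
/-- The eigenvalue of `T_H(x_i x_{i'})` at the monomial `x^(α) x^u`. -/
def weight (i : Fin n) (x : (Fin n → ℕ) × Finset (Fin n)) : F :=
  (if i ∈ x.2 then 1 else 0) - x.1 i

theorem quad_mem_homog (i j : Fin n) : quad F i j ∈ homog F 2 :=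
  mon_mem_homog (by simp)

theorem pd_inl_quad (k i j : Fin n) :
    pd F n (Sum.inl k) (quad F i j) = if k = i then X F n (Sum.inr j) else 0 := by
  split_ifs with h <;> simp [quad, pd_inl_mon, X, h]

theorem TH_X_inr (i : Fin n) (a : OO F n) :
    TH F (X F n (Sum.inr i)) a = -pd F n (Sum.inl i) a := by
  have hmul : mul F n (mon F n 0 ∅) = LinearMap.id := hom_ext F fun β v => by
    simp [mul_mon, binom, eps_empty_left]
  have hsig : sig F n (X F n (Sum.inr i)) = -X F n (Sum.inr i) := by simp [X, sig_mon]
  rw [TH_apply, Fintype.sum_sum_type, Finset.sum_eq_zero, zero_add, Finset.sum_eq_single i]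
  · simp [hsig, pd_X, hmul]
  · intro j _ hj
    simp [hsig, pd_X, hj]
  · simp
  · simp [pd_X]

theorem TH_X_inr_right (a : OO F n) (i : Fin n) :
    TH F a (X F n (Sum.inr i)) = pd F n (Sum.inl i) a := by
  rw [TH_eq_vf, vf_X]
  simp [thc]

theorem TH_quad (i j : Fin n) (a : OO F n) :
    TH F (quad F i j) a = mul F n (X F n (Sum.inr j)) (pd F n (Sum.inr i) a) -
      mul F n (X F n (Sum.inl i)) (pd F n (Sum.inl j) a) := by
  have hsig : sig F n (quad F i j) = -quad F i j := by simp [quad, sig_mon]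
  have hinr (k : Fin n) :
      pd F n (Sum.inr k) (quad F i j) = if k = j then X F n (Sum.inl i) else 0 := by
    split_ifs with h <;> simp [quad, pd_inr_mon, X, inv, Finset.filter_singleton, h]
  rw [TH_apply, Fintype.sum_sum_type, Finset.sum_eq_single i, Finset.sum_eq_single j,
    sub_eq_add_neg]
  · simp [hsig, pd_inl_quad, hinr]
  · intro k _ hk
    simp [hsig, hinr, hk]
  · simp
  · intro k _ hk
    simp [pd_inl_quad, hk]
  · simp

theorem TH_quad_self_apply (i : Fin n) (a : OO F n) (x : (Fin n → ℕ) × Finset (Fin n)) :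
    TH F (quad F i i) a x = weight F i x * a x := by
  obtain ⟨α, u⟩ := x
  rw [TH_quad, Finsupp.sub_apply, X_inl_mul_apply, X_inr_mul_pd_inr_apply, weight, sub_mul]
  congr 1
  · rw [ite_mul, one_mul, zero_mul]
  · rcases eq_or_ne (α i) 0 with h | h
    · simp [h]
    · rw [apply_eq_pd_inl_apply h]

theorem TH_quad_self_mon (i : Fin n) (α : Fin n → ℕ) (u : Finset (Fin n)) :
    TH F (quad F i i) (mon F n α u) = weight F i (α, u) • mon F n α u := by
  ext x
  rw [TH_quad_self_apply, Finsupp.smul_apply, smul_eq_mul, mon_apply]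
  split_ifs with h
  · rw [h]
  · simp

theorem eq_of_weight_eq [CharP F p] (hp : 2 < p) {α : Fin n → ℕ} {u v : Finset (Fin n)}
    (hdeg : ∑ i, α i + v.card ≤ u.card) (hw : ∀ i, weight F i (α, v) = weight F i (0, u)) :
    α = 0 ∧ v = u := by
  have hdvd (i : Fin n) (hu : i ∈ u) (hv : i ∉ v) : p ∣ α i + 1 := by
    have := hw i
    simp only [weight, hu, hv, if_true, if_false, Pi.zero_apply, Nat.cast_zero] at this
    rw [← CharP.cast_eq_zero_iff F p, Nat.cast_add, Nat.cast_one]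
    linear_combination -this
  have hle (i : Fin n) : (if i ∈ u then 1 else 0) ≤ α i + if i ∈ v then 1 else 0 := by
    split_ifs with hu hv
    · omega
    · have := Nat.le_of_dvd (by omega) (hdvd i hu hv)
      omega
    all_goals omega
  have hsum := (Finset.sum_eq_sum_iff_of_le fun i (_ : i ∈ Finset.univ) => hle i).1 <|
    le_antisymm (Finset.sum_le_sum fun i _ => hle i)
      (by simpa [Finset.sum_add_distrib] using hdeg)
  have hi (i : Fin n) : α i = 0 ∧ (i ∈ v ↔ i ∈ u) := by
    have h := hsum i (Finset.mem_univ i)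
    by_cases hu : i ∈ u <;> by_cases hv : i ∈ v <;> simp only [hu, hv, if_true, if_false] at h
    · exact ⟨by omega, by simp [hu, hv]⟩
    · have := Nat.le_of_dvd (by omega) (hdvd i hu hv)
      omega
    · omega
    · exact ⟨by omega, by simp [hu, hv]⟩
  exact ⟨funext fun i => (hi i).1, Finset.ext fun i => (hi i).2⟩

end LowDegree

section OddPart

variable (F p t) in
/-- The odd part of `𝒪(n, n; t)`; `T_H` identifies it with `ℋ𝒪`, the bracket of `ℋ𝒪` becoming
`(a, b) ↦ T_H(a)(b)`. -/
noncomputable def OddPart : Submodule F (OO F n) := OT F p t ⊓ par F n 1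

theorem OddPart_eq_supported : OddPart F p t = Finsupp.supported F F
    {x | (∀ i, x.1 i < p ^ t i) ∧ x.2.card ≡ 1 [MOD 2]} :=
  (Finsupp.supported_inter _ _).symm

theorem mem_OddPart {a : OO F n} : a ∈ OddPart F p t ↔
    ∀ α u, a (α, u) ≠ 0 → (∀ i, α i < p ^ t i) ∧ u.card ≡ 1 [MOD 2] := by
  simp only [OddPart_eq_supported, Finsupp.mem_supported', not_imp_comm, Prod.forall,
    Set.mem_ofPred_eq]

theorem mon_mem_OddPart {α : Fin n → ℕ} {u : Finset (Fin n)} (hα : ∀ i, α i < p ^ t i)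
    (hu : u.card ≡ 1 [MOD 2]) : mon F n α u ∈ OddPart F p t :=
  ⟨mon_mem F hα, mon_mem F hu⟩

theorem map_eq_of_map_mon_eq {M : Type*} [AddCommGroup M] [Module F M] {f g : OO F n →ₗ[F] M}
    (h : ∀ α u, (∀ i, α i < p ^ t i) → u.card ≡ 1 [MOD 2] → f (mon F n α u) = g (mon F n α u))
    {a : OO F n} (ha : a ∈ OddPart F p t) : f a = g a := by
  rw [OddPart_eq_supported] at ha
  have := map_supported F (N := ⊥) (f - g) (fun α u hu => by simp [h α u hu.1 hu.2]) ha
  simpa [sub_eq_zero] using this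

theorem apply_empty_eq_zero {a : OO F n} (ha : a ∈ OddPart F p t) (α : Fin n → ℕ) :
    a (α, ∅) = 0 := by
  by_contra h
  simpa [Nat.ModEq] using (mem_OddPart.1 ha _ _ h).2

theorem pd_inl_apply_eq_zero_of_top {a : OO F n} (ha : a ∈ OddPart F p t) {i : Fin n}
    {α : Fin n → ℕ} (hα : α i = p ^ t i - 1) (u : Finset (Fin n)) :
    pd F n (Sum.inl i) a (α, u) = 0 := by
  rw [pd_inl_apply]
  by_contra h
  have := (mem_OddPart.1 ha _ _ h).1 i
  simp only [Pi.add_apply, Pi.single_eq_same] at this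
  omega

section

variable [Fact p.Prime]

theorem mon_zero_mem_OddPart {u : Finset (Fin n)} (hu : u.card ≡ 1 [MOD 2]) :
    mon F n 0 u ∈ OddPart F p t :=
  mon_mem_OddPart (fun _ => pow_pos (Fact.out : p.Prime).pos _) hu

theorem X_inr_mem_OddPart (i : Fin n) : X F n (Sum.inr i) ∈ OddPart F p t :=
  mon_zero_mem_OddPart (by simp [Nat.ModEq])

theorem quad_mem_OddPart (ht : ∀ i, 0 < t i) (i j : Fin n) : quad F i j ∈ OddPart F p t := by
  refine mon_mem_OddPart (fun l => ?_) (by simp [Nat.ModEq])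
  have hl : 1 < p ^ t l := Nat.one_lt_pow (ht l).ne' (Fact.out : p.Prime).one_lt
  rcases eq_or_ne l i with rfl | h
  · simpa using hl
  · simpa [h] using zero_lt_one.trans hl

theorem TH_mem_OddPart [CharP F p] {a b : OO F n} (ha : a ∈ OddPart F p t)
    (hb : b ∈ OddPart F p t) : TH F a b ∈ OddPart F p t := by
  rw [TH_eq_vf]
  refine ⟨vf_OT F p t (fun r => pd_OT F p t _ (sig_OT F p t _ ha.1)) hb.1, ?_⟩
  simpa using vf_par F (θ := 0) (fun r => by simpa using thc_odd F ha.2 r) hb.2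

end

end OddPart

variable (p t) in
/-- `D` restricts to a derivation of degree `k` of the odd part of `𝒪(n, n; t)` under the bracket
`(a, b) ↦ T_H(a)(b)`; its values outside the odd part play no role. -/
structure IsBracketDerivation (k : ℤ) (D : OO F n →ₗ[F] OO F n) : Prop where
  map_mem : ∀ {a}, a ∈ OddPart F p t → D a ∈ OddPart F p t
  leibniz : ∀ {a b}, a ∈ OddPart F p t → b ∈ OddPart F p t →
    D (TH F a b) = TH F (D a) b + TH F a (D b)
  map_homog : ∀ {m a}, a ∈ OddPart F p t → a ∈ homog F m → D a ∈ homog F (m + k)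

theorem exists_pd_inl_apply_ne_zero {c : OO F n} (h₀ : ∀ u, c (0, u) = 0) {α : Fin n → ℕ}
    {u : Finset (Fin n)} (h : c (α, u) ≠ 0) :
    ∃ i, α i ≠ 0 ∧ pd F n (Sum.inl i) c (α - Pi.single i 1, u) ≠ 0 := by
  obtain ⟨i, hi⟩ : ∃ i, α i ≠ 0 := Function.ne_iff.1 fun e => h (e ▸ h₀ u)
  exact ⟨i, hi, by rwa [← apply_eq_pd_inl_apply hi]⟩

theorem homog_of_pd_inl {c : OO F n} (h₀ : ∀ u, c (0, u) = 0) {m : ℤ}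
    (h : ∀ i, pd F n (Sum.inl i) c ∈ homog F m) : c ∈ homog F (m + 1) := by
  rw [mem_homog]
  intro α u hc
  obtain ⟨i, hi, hci⟩ := exists_pd_inl_apply_ne_zero h₀ hc
  have := mem_homog.1 (h i) _ _ hci
  rw [← sum_sub_single_add_one hi]
  omega

theorem mem_OddPart_of_pd_inl {c : OO F n} (h₀ : ∀ u, c (0, u) = 0)
    (h : ∀ i, pd F n (Sum.inl i) c ∈ OddPart F p t)
    (htop : ∀ i α u, α i = p ^ t i - 1 → pd F n (Sum.inl i) c (α, u) = 0) :
    c ∈ OddPart F p t := by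
  rw [mem_OddPart]
  intro α u hc
  obtain ⟨i, hi, hci⟩ := exists_pd_inl_apply_ne_zero h₀ hc
  obtain ⟨hα, hu⟩ := mem_OddPart.1 (h i) _ _ hci
  refine ⟨fun j => ?_, hu⟩
  have hj := hα j
  rcases eq_or_ne j i with rfl | hij
  · have := mt (htop j (α - Pi.single j 1) u) hci
    simp only [Pi.sub_apply, Pi.single_eq_same] at hj this
    omega
  · simpa [hij] using hj

/-- The value at `α` is read off from any `i` with `α_i ≠ 0`; closedness of the family makes it
independent of `i`. -/
theorem exists_pd_inl_eq (b : Fin n → OO F n)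
    (hb : ∀ i j, pd F n (Sum.inl j) (b i) = pd F n (Sum.inl i) (b j)) :
    ∃ c : OO F n, (∀ u, c (0, u) = 0) ∧ ∀ i, pd F n (Sum.inl i) c = b i := by
  classical
  have hindep (α : Fin n → ℕ) (u : Finset (Fin n)) (i j : Fin n) (hi : α i ≠ 0) (hj : α j ≠ 0) :
      b i (α - Pi.single i 1, u) = b j (α - Pi.single j 1, u) := by
    rcases eq_or_ne i j with rfl | hij
    · rfl
    · rw [apply_eq_pd_inl_apply (i := j) (by simpa [hij.symm] using hj), hb,
        apply_eq_pd_inl_apply (i := i) (α := α - Pi.single j 1) (by simpa [hij] using hi),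
        tsub_right_comm]
  let g (x : (Fin n → ℕ) × Finset (Fin n)) : F :=
    if h : ∃ i, x.1 i ≠ 0 then b h.choose (x.1 - Pi.single h.choose 1, x.2) else 0
  have hg (α : Fin n → ℕ) (u : Finset (Fin n)) (i : Fin n) (hi : α i ≠ 0) :
      g (α, u) = b i (α - Pi.single i 1, u) := by
    have h : ∃ i, α i ≠ 0 := ⟨i, hi⟩
    simp only [g, dif_pos h]
    exact hindep α u _ i h.choose_spec hi
  have hfin : g.support.Finite := by
    refine (Set.finite_iUnion fun i : Fin n =>
      ((b i).support.finite_toSet.image fun x => (x.1 + Pi.single i 1, x.2))).subset ?_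
    rintro ⟨α, u⟩ h
    obtain ⟨i, hi⟩ : ∃ i, α i ≠ 0 := by
      by_contra h'
      exact h (dif_neg h')
    rw [Function.mem_support, hg α u i hi] at h
    exact Set.mem_iUnion.2
      ⟨i, (α - Pi.single i 1, u), by simpa using h, by simp [sub_single_add_single hi]⟩
  refine ⟨Finsupp.ofSupportFinite g hfin, fun u => dif_neg (by simp), fun i => ?_⟩
  ext ⟨α, u⟩
  rw [pd_inl_apply, Finsupp.ofSupportFinite_coe, hg _ u i (by simp), add_tsub_cancel_right]

section Derivations

variable {k : ℤ} {D : OO F n →ₗ[F] OO F n}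

namespace IsBracketDerivation

theorem sub_TH [Fact p.Prime] [CharP F p] (hD : IsBracketDerivation p t k D) {b : OO F n}
    (hb : b ∈ OddPart F p t) (hbk : b ∈ homog F (k + 2)) :
    IsBracketDerivation p t k (D - TH F b) where
  map_mem ha := Submodule.sub_mem _ (hD.map_mem ha) (TH_mem_OddPart hb ha)
  leibniz {x y} hx hy := by
    have h : TH F b (TH F x y) = TH F (TH F b x) y + TH F x (TH F b y) := by
      rw [← sub_eq_iff_eq_add]
      exact LinearMap.congr_fun (lie_TH F hb.2 hx.2) y
    simp only [LinearMap.sub_apply, hD.leibniz hx hy, map_sub, h]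
    abel
  map_homog {m a} ha ham := by
    have h := TH_homog hbk ham
    rw [show k + 2 + m - 2 = m + k by ring] at h
    exact Submodule.sub_mem _ (hD.map_homog ha ham) h

theorem pd_inl_map [Fact p.Prime] (hD : IsBracketDerivation p t k D) (i : Fin n) {a : OO F n}
    (ha : a ∈ OddPart F p t) :
    pd F n (Sum.inl i) (D a) = D (pd F n (Sum.inl i) a) - TH F a (D (X F n (Sum.inr i))) := by
  have hX : X F n (Sum.inr i) ∈ OddPart F p t := X_inr_mem_OddPart i
  have h := hD.leibniz hX ha
  rw [TH_X_inr, TH_X_inr, map_neg, TH_skew F ha.2 (hD.map_mem hX).2] at h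
  linear_combination (norm := module) h

/-- At the top exponent of `x_i` the left side of `pd_inl_map` vanishes; it is applied to
`x_i x_{i'}` and to the `x_j x_{i'}`. -/
theorem map_X_inr_apply_eq_zero_of_top [Fact p.Prime] [CharP F p]
    (hD : IsBracketDerivation p t k D) (ht : ∀ i, 0 < t i) (i : Fin n) {α : Fin n → ℕ}
    (hα : α i = p ^ t i - 1) (w : Finset (Fin n)) : D (X F n (Sum.inr i)) (α, w) = 0 := by
  have hb := hD.map_mem (X_inr_mem_OddPart (t := t) i)
  set b := D (X F n (Sum.inr i))
  have hcoeff {f : OO F n} (hf : f ∈ OddPart F p t) (u : Finset (Fin n)) :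
      TH F f b (α, u) = D (pd F n (Sum.inl i) f) (α, u) := by
    have h := DFunLike.congr_fun (hD.pd_inl_map i hf) (α, u)
    rw [pd_inl_apply_eq_zero_of_top (hD.map_mem hf) hα, Finsupp.sub_apply] at h
    exact (sub_eq_zero.1 h.symm).symm
  have hcast : (α i : F) = -1 := by
    rw [hα, Nat.cast_pred (pow_pos (Fact.out : p.Prime).pos _), Nat.cast_pow,
      CharP.cast_eq_zero, zero_pow (ht i).ne', zero_sub]
  by_cases hi : i ∈ w
  · have h := hcoeff (quad_mem_OddPart ht i i) w
    rw [TH_quad_self_apply, weight, if_pos hi, hcast, pd_inl_quad, if_pos rfl] at h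
    linear_combination h
  · rcases w.eq_empty_or_nonempty with rfl | ⟨j, hj⟩
    · exact apply_empty_eq_zero hb α
    have hji : i ≠ j := fun e => hi (e ▸ hj)
    have h := hcoeff (quad_mem_OddPart ht j i) (insert i (w.erase j))
    have htop : (α - Pi.single j 1 : Fin n → ℕ) i = p ^ t i - 1 := by simpa [hji] using hα
    have hiw : i ∉ w.erase j := fun h => hi (Finset.mem_of_mem_erase h)
    rw [pd_inl_quad, if_neg hji, map_zero, Finsupp.zero_apply, TH_quad, Finsupp.sub_apply,
      X_inl_mul_apply, pd_inl_apply_eq_zero_of_top hb htop, X_inr_mul_apply,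
      if_pos (Finset.mem_insert_self _ _), Finset.erase_insert hiw, pd_inr_apply,
      if_neg (w.notMem_erase j), Finset.insert_erase hj, mul_zero, sub_zero] at h
    exact ((mul_eq_zero_iff_left (eps_ne_zero (by simp))).1
      ((mul_eq_zero_iff_left (eps_ne_zero (by simpa using hiw))).1 h))

theorem exists_sub_TH_map_X_inr_eq_zero [Fact p.Prime] [CharP F p]
    (hD : IsBracketDerivation p t k D) (ht : ∀ i, 0 < t i) :
    ∃ b ∈ OddPart F p t ⊓ homog F (k + 2), ∀ i, (D - TH F b) (X F n (Sum.inr i)) = 0 := by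
  have hX (i : Fin n) : X F n (Sum.inr i) ∈ OddPart F p t := X_inr_mem_OddPart i
  obtain ⟨b, h₀, h⟩ := exists_pd_inl_eq (fun i => D (X F n (Sum.inr i))) fun i j => by
    rw [hD.pd_inl_map j (hX i), TH_X_inr, pd_X, if_neg (by simp), map_zero, zero_sub, neg_neg]
  refine ⟨b, ⟨mem_OddPart_of_pd_inl h₀ (fun i => ?_) fun i α u hα => ?_, ?_⟩, fun i => ?_⟩
  · exact h i ▸ hD.map_mem (hX i)
  · rw [h i, hD.map_X_inr_apply_eq_zero_of_top ht i hα]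
  · rw [show k + 2 = 1 + k + 1 by ring]
    exact homog_of_pd_inl h₀ fun i => h i ▸ hD.map_homog (hX i) (X_mem_homog _)
  · rw [LinearMap.sub_apply, TH_X_inr_right, h i, sub_self]

theorem pd_inl_comm [Fact p.Prime] (hD : IsBracketDerivation p t k D)
    (hX : ∀ i, D (X F n (Sum.inr i)) = 0) (i : Fin n) {a : OO F n} (ha : a ∈ OddPart F p t) :
    pd F n (Sum.inl i) (D a) = D (pd F n (Sum.inl i) a) := by
  rw [hD.pd_inl_map i ha, hX, map_zero, sub_zero]

theorem map_quad_apply_eq_zero [Fact p.Prime] (hD : IsBracketDerivation p t k D)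
    (ht : ∀ i, 0 < t i) (hX : ∀ i, D (X F n (Sum.inr i)) = 0) (i j : Fin n) {α : Fin n → ℕ}
    (hα : α ≠ 0) (u : Finset (Fin n)) : D (quad F i j) (α, u) = 0 := by
  obtain ⟨l, hl⟩ := Function.ne_iff.1 hα
  rw [apply_eq_pd_inl_apply hl, hD.pd_inl_comm hX l (quad_mem_OddPart ht i j), pd_inl_quad]
  split_ifs <;> simp [hX]

theorem weight_mul_map_quad_apply [Fact p.Prime] (hD : IsBracketDerivation p t k D)
    (ht : ∀ i, 0 < t i) (i j : Fin n) (x : (Fin n → ℕ) × Finset (Fin n)) :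
    weight F i x * D (quad F j j) x = weight F j x * D (quad F i i) x := by
  have hi := quad_mem_OddPart (F := F) (p := p) ht i i
  have hj := quad_mem_OddPart (F := F) (p := p) ht j j
  have h₀ : TH F (quad F i i) (quad F j j) = 0 := by
    rw [quad, quad, ← quad, TH_quad_self_mon]
    rcases eq_or_ne i j with rfl | h <;> simp [weight, *]
  have h := hD.leibniz hi hj
  rw [h₀, map_zero, TH_skew F hj.2 (hD.map_mem hi).2, neg_add_eq_sub, eq_comm, sub_eq_zero] at h
  simpa only [TH_quad_self_apply] using DFunLike.congr_fun h x

theorem exists_sub_TH_map_quad_eq_zero [Fact p.Prime]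
    (hD : IsBracketDerivation p t k D) (ht : ∀ i, 0 < t i)
    (hX : ∀ i, D (X F n (Sum.inr i)) = 0) :
    ∃ b ∈ OddPart F p t ⊓ homog F (k + 2),
      (∀ i, (D - TH F b) (X F n (Sum.inr i)) = 0) ∧ ∀ i, (D - TH F b) (quad F i i) = 0 := by
  have hq (i : Fin n) : quad F i i ∈ OddPart F p t := quad_mem_OddPart ht i i
  have hg₀ {i : Fin n} {α : Fin n → ℕ} {u : Finset (Fin n)} (h : D (quad F i i) (α, u) ≠ 0) :
      α = 0 := not_imp_comm.1 (hD.map_quad_apply_eq_zero ht hX i i · u) h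
  obtain ⟨b, hb, hsupp⟩ := exists_finsupp_eq_mul (w := weight F) (g := fun i => D (quad F i i))
    (hD.weight_mul_map_quad_apply ht) (by
      rintro i ⟨α, u⟩ h
      obtain rfl := hg₀ h
      obtain ⟨j, hj⟩ : u.Nonempty := Finset.nonempty_iff_ne_empty.2 fun e =>
        h (e ▸ apply_empty_eq_zero (hD.map_mem (hq i)) 0)
      exact ⟨j, by simp [weight, hj]⟩)
  have hbO : b ∈ OddPart F p t := mem_OddPart.2 fun α u h =>
    let ⟨i, hi⟩ := hsupp _ h
    mem_OddPart.1 (hD.map_mem (hq i)) α u hi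
  have hbk : b ∈ homog F (k + 2) := mem_homog.2 fun α u h =>
    let ⟨i, hi⟩ := hsupp _ h
    (mem_homog.1 (hD.map_homog (hq i) (quad_mem_homog i i)) α u hi).trans (add_comm 2 k)
  refine ⟨-b, ⟨neg_mem hbO, neg_mem hbk⟩, fun i => ?_, fun i => ?_⟩
  · rw [LinearMap.sub_apply, hX, TH_X_inr_right, zero_sub, map_neg, neg_neg]
    ext ⟨α, u⟩
    rw [pd_inl_apply]
    by_contra h
    obtain ⟨j, hj⟩ := hsupp _ h
    simpa using congr_fun (hg₀ hj) i
  · ext x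
    rw [LinearMap.sub_apply, map_neg, LinearMap.neg_apply, sub_neg_eq_add,
      TH_skew F (hq i).2 hbO.2, ← sub_eq_add_neg, Finsupp.sub_apply, TH_quad_self_apply, hb,
      sub_self, Finsupp.zero_apply]

theorem map_TH_quad_self [Fact p.Prime] (hD : IsBracketDerivation p t k D) (ht : ∀ i, 0 < t i)
    (hq : ∀ i, D (quad F i i) = 0) (i : Fin n) {a : OO F n} (ha : a ∈ OddPart F p t) :
    D (TH F (quad F i i) a) = TH F (quad F i i) (D a) := by
  rw [hD.leibniz (quad_mem_OddPart ht i i) ha, hq, map_zero, LinearMap.zero_apply, zero_add]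

theorem weight_eq [Fact p.Prime] (hD : IsBracketDerivation p t k D) (ht : ∀ i, 0 < t i)
    (hq : ∀ i, D (quad F i i) = 0) {α : Fin n → ℕ} {v : Finset (Fin n)}
    (ha : mon F n α v ∈ OddPart F p t) {x : (Fin n → ℕ) × Finset (Fin n)}
    (hx : D (mon F n α v) x ≠ 0) (i : Fin n) : weight F i (α, v) = weight F i x := by
  have h := DFunLike.congr_fun (hD.map_TH_quad_self ht hq i ha) x
  rw [TH_quad_self_mon, map_smul, TH_quad_self_apply] at h
  exact mul_right_cancel₀ hx h

variable [Fact p.Prime] [CharP F p]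

theorem map_mon_apply_zero_eq_zero (hD : IsBracketDerivation p t k D) (hk : 0 ≤ k) (hp : 2 < p)
    (ht : ∀ i, 0 < t i) (hq : ∀ i, D (quad F i i) = 0) {α : Fin n → ℕ} {u v : Finset (Fin n)}
    (ha : mon F n α v ∈ OddPart F p t) (h : (α, v) ≠ (0, u)) : D (mon F n α v) (0, u) = 0 := by
  by_contra hne
  have hdeg := mem_homog.1 (hD.map_homog ha (mon_mem_homog rfl)) 0 u hne
  simp only [Pi.zero_apply, Finset.sum_const_zero] at hdeg
  obtain ⟨hα, hv⟩ := eq_of_weight_eq hp (by omega) (hD.weight_eq ht hq ha hne)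
  exact h (by rw [hα, hv])

theorem map_mon (hD : IsBracketDerivation p t k D) (hk : 0 ≤ k) (hp : 2 < p)
    (ht : ∀ i, 0 < t i) (hX : ∀ i, D (X F n (Sum.inr i)) = 0) (hq : ∀ i, D (quad F i i) = 0)
    {α : Fin n → ℕ} {v : Finset (Fin n)} (hα : ∀ i, α i < p ^ t i) (hv : v.card ≡ 1 [MOD 2]) :
    D (mon F n α v) = D (mon F n 0 v) (0, v) • mon F n α v := by
  induction α using WellFoundedLT.induction with
  | ind α ih =>
  have ha : mon F n α v ∈ OddPart F p t := mon_mem_OddPart hα hv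
  have hpd (i : Fin n) : pd F n (Sum.inl i) (D (mon F n α v)) =
      pd F n (Sum.inl i) (D (mon F n 0 v) (0, v) • mon F n α v) := by
    rw [hD.pd_inl_comm hX i ha, map_smul, pd_inl_mon]
    split_ifs with hi
    · simp
    · exact ih _ (sub_single_lt hi) fun j => ((sub_single_lt hi).le j).trans_lt (hα j)
  ext ⟨β, u⟩
  by_cases hβ : β = 0
  · subst hβ
    by_cases h : (α, v) = (0, u)
    · obtain ⟨rfl, rfl⟩ := Prod.mk.inj h
      simp [mon_apply]
    · rw [hD.map_mon_apply_zero_eq_zero hk hp ht hq ha h, Finsupp.smul_apply, mon_apply, if_neg h,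
        smul_zero]
  · obtain ⟨i, hi⟩ := Function.ne_iff.1 hβ
    rw [apply_eq_pd_inl_apply hi, hpd, ← apply_eq_pd_inl_apply hi]

end IsBracketDerivation

variable (F) in
/-- The operator `∑ x_{i'} ∂_{i'}` on `𝒪(n, n)`, underlying `Gam`. -/
noncomputable def oddEuler : OO F n →ₗ[F] OO F n :=
  vf F (Sum.elim 0 fun i => X F n (Sum.inr i))

theorem oddEuler_apply (a : OO F n) (x : (Fin n → ℕ) × Finset (Fin n)) :
    oddEuler F a x = x.2.card * a x := by
  obtain ⟨α, u⟩ := x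
  rw [oddEuler, vf_apply, Fintype.sum_sum_type, Finset.sum_eq_zero (by simp), zero_add,
    Finsupp.finsetSum_apply]
  simp [X_inr_mul_pd_inr_apply]

theorem TH_mon_exterior {i : Fin n} {v w : Finset (Fin n)} (hi : i ∈ w)
    (hvw : Disjoint v (w.erase i)) :
    ∃ s : F, s ≠ 0 ∧
      TH F (mon F n (Pi.single i 1) v) (mon F n 0 w) = s • mon F n 0 (v ∪ w.erase i) := by
  refine ⟨eps F {i} (w.erase i) * eps F v (w.erase i),
    mul_ne_zero (eps_ne_zero (by simp)) (eps_ne_zero hvw), ?_⟩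
  rw [TH_apply, Fintype.sum_sum_type, Finset.sum_eq_single i, Finset.sum_eq_zero, add_zero]
  · simp [pd_inl_mon, pd_inr_mon', hi, mul_mon, binom, smul_smul]
  · simp [pd_inl_mon]
  · intro j _ hj
    simp [pd_inl_mon, hj]
  · simp

namespace IsBracketDerivation

variable [Fact p.Prime] [CharP F p]

theorem map_mon_union (hD : IsBracketDerivation p t k D) (hk : 0 ≤ k) (hp : 2 < p)
    (ht : ∀ i, 0 < t i) (hX : ∀ i, D (X F n (Sum.inr i)) = 0) (hq : ∀ i, D (quad F i i) = 0)
    {i : Fin n} {v w : Finset (Fin n)} (hv : v.card ≡ 1 [MOD 2]) (hw : w.card ≡ 1 [MOD 2])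
    (hi : i ∈ w) (hvw : Disjoint v (w.erase i)) :
    D (mon F n 0 (v ∪ w.erase i)) (0, v ∪ w.erase i) =
      D (mon F n 0 v) (0, v) + D (mon F n 0 w) (0, w) := by
  have hα : ∀ j, (Pi.single i 1 : Fin n → ℕ) j < p ^ t j :=
    (mem_OddPart.1 (quad_mem_OddPart (F := F) ht i i) _ {i} (by simp [quad, mon_apply])).1
  obtain ⟨s, hs, hTH⟩ := TH_mon_exterior (F := F) hi hvw
  have h := hD.leibniz (mon_mem_OddPart hα hv) (mon_zero_mem_OddPart hw)
  rw [hD.map_mon hk hp ht hX hq hα hv, hD.map_mon (α := 0) hk hp ht hX hq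
    (fun _ => pow_pos (Fact.out : p.Prime).pos _) hw, map_smul, map_smul, LinearMap.smul_apply,
    hTH, map_smul, ← add_smul] at h
  have := DFunLike.congr_fun h (0, v ∪ w.erase i)
  simp only [Finsupp.smul_apply, smul_eq_mul, mon_apply, if_true, mul_one] at this
  exact mul_left_cancel₀ hs (this.trans (mul_comm _ _))

theorem exists_eq_smul_oddEuler_sub (hD : IsBracketDerivation p t k D) (hk : 0 ≤ k) (hp : 2 < p)
    (ht : ∀ i, 0 < t i) (hX : ∀ i, D (X F n (Sum.inr i)) = 0) (hq : ∀ i, D (quad F i i) = 0) :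
    ∃ κ : F, (k ≠ 0 → κ = 0) ∧ ∀ a ∈ OddPart F p t, D a = κ • (oddEuler F a - a) := by
  have h2 : (2 : F) ≠ 0 := Ring.two_ne_zero (by rw [ringChar.eq F p]; omega)
  obtain ⟨κ, hκ⟩ : ∃ κ : F, (k ≠ 0 → κ = 0) ∧
      ∀ v, v.card ≡ 1 [MOD 2] → D (mon F n 0 v) (0, v) = κ * (v.card - 1) := by
    rcases eq_or_ne k 0 with rfl | hk0
    · obtain ⟨κ, hκ⟩ := exists_eq_mul_card_sub_one h2
        (c := fun v => D (mon F n 0 v) (0, v))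
        (fun i => DFunLike.congr_fun (hX i) _)
        (fun hv hw hi hvw => hD.map_mon_union hk hp ht hX hq hv hw hi hvw)
      exact ⟨κ, fun h => absurd rfl h, hκ⟩
    · refine ⟨0, fun _ => rfl, fun v hv => ?_⟩
      rw [zero_mul]
      by_contra h
      have := mem_homog.1 (hD.map_homog (mon_zero_mem_OddPart hv) (mon_mem_homog rfl)) _ _ h
      omega
  refine ⟨κ, hκ.1, fun a ha => map_eq_of_map_mon_eq
    (g := κ • (oddEuler F - LinearMap.id)) (fun α u hα hu => ?_) ha⟩
  rw [hD.map_mon hk hp ht hX hq hα hu, hκ.2 u hu]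
  ext x
  simp only [Finsupp.smul_apply, LinearMap.smul_apply, LinearMap.sub_apply, LinearMap.id_apply,
    Finsupp.sub_apply, smul_eq_mul, oddEuler_apply, mon_apply]
  split_ifs with h
  · rw [← h]
    ring
  · ring

theorem exists_eq_TH_add_smul_oddEuler_sub (hD : IsBracketDerivation p t k D) (hk : 0 ≤ k)
    (hp : 2 < p) (ht : ∀ i, 0 < t i) :
    ∃ b ∈ OddPart F p t ⊓ homog F (k + 2), ∃ κ : F, (k ≠ 0 → κ = 0) ∧
      ∀ a ∈ OddPart F p t, D a = TH F b a + κ • (oddEuler F a - a) := by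
  obtain ⟨b, hb, hX⟩ := hD.exists_sub_TH_map_X_inr_eq_zero ht
  have hD' := hD.sub_TH hb.1 hb.2
  obtain ⟨c, hc, hX', hq⟩ := hD'.exists_sub_TH_map_quad_eq_zero ht hX
  obtain ⟨κ, hκ, h⟩ := (hD'.sub_TH hc.1 hc.2).exists_eq_smul_oddEuler_sub hk hp ht hX' hq
  refine ⟨b + c, add_mem hb hc, κ, hκ, fun a ha => ?_⟩
  rw [← h a ha, map_add]
  simp only [LinearMap.add_apply, LinearMap.sub_apply]
  abel

end IsBracketDerivation

end Derivations

variable {k : ℤ}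

theorem thc_eq_smul_pd {a : OO F n} (ha : a ∈ par F n 1) (s : Y n) :
    thc F a s = (-1 : F) ^ mu s.swap • pd F n s.swap a := by
  rw [thc, sig_pow_par F _ ha, mul_one, map_smul]

theorem TH_injOn_OddPart : Set.InjOn (TH F (n := n)) (OddPart F p t) := by
  intro a ha b hb hab
  refine sub_eq_zero.1 (eq_zero_of_pd_eq_zero (fun r => ?_)
    (apply_empty_eq_zero (Submodule.sub_mem _ ha hb) 0))
  have h : thc F a r.swap = thc F b r.swap := by
    rw [← vf_X F (thc F a), ← vf_X F (thc F b), ← TH_eq_vf, ← TH_eq_vf, hab]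
  rw [thc_eq_smul_pd ha.2, thc_eq_smul_pd hb.2, Sum.swap_swap] at h
  rw [map_sub, sub_eq_zero]
  exact smul_right_injective _ (pow_ne_zero _ (neg_ne_zero.2 one_ne_zero)) h

theorem oddEuler_mem_supported {S : Set ((Fin n → ℕ) × Finset (Fin n))} {a : OO F n}
    (ha : a ∈ Finsupp.supported F F S) : oddEuler F a ∈ Finsupp.supported F F S := by
  rw [Finsupp.mem_supported'] at ha ⊢
  intro x hx
  rw [oddEuler_apply, ha x hx, mul_zero]

theorem oddEuler_pd_inl (i : Fin n) (a : OO F n) :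
    oddEuler F (pd F n (Sum.inl i) a) = pd F n (Sum.inl i) (oddEuler F a) := by
  ext ⟨α, u⟩
  simp only [oddEuler_apply, pd_inl_apply]

theorem oddEuler_pd_inr (i : Fin n) (a : OO F n) :
    oddEuler F (pd F n (Sum.inr i) a) = pd F n (Sum.inr i) (oddEuler F a - a) := by
  ext ⟨α, u⟩
  simp only [oddEuler_apply, pd_inr_apply, Finsupp.sub_apply]
  split_ifs with hi
  · rw [mul_zero]
  · rw [Finset.card_insert_of_notMem hi, Nat.cast_succ]
    ring

theorem lie_oddEuler_TH {a : OO F n} (ha : a ∈ par F n 1) :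
    oddEuler F * TH F a - TH F a * oddEuler F = TH F (oddEuler F a - a) := by
  have hΓ : ∀ r, (Sum.elim 0 fun i => X F n (Sum.inr i) : Y n → OO F n) r ∈ par F n (mu r) := by
    rintro (i | i)
    · exact Submodule.zero_mem _
    · exact mon_mem F rfl
  have hΓa : oddEuler F a - a ∈ par F n 1 := Submodule.sub_mem _ (oddEuler_mem_supported ha) ha
  rw [TH_eq_vf, oddEuler, lie_vf F hΓ (thc_odd F ha), ← TH_eq_vf, ← oddEuler, TH_eq_vf F (_ - _)]
  congr 1
  funext s
  rw [thc_eq_smul_pd ha, thc_eq_smul_pd hΓa, map_smul]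
  rcases s with i | i
  · simp only [Sum.swap_inl, oddEuler_pd_inr, Sum.elim_inl, Pi.zero_apply, map_zero, sub_zero]
  · simp only [Sum.swap_inr, mu_inl, pow_zero, one_smul, oddEuler_pd_inl, Sum.elim_inr,
      TH_X_inr_right, map_sub]

section IsoHO

variable [Fact p.Prime] [CharP F p]

theorem TH_mem_WW {a : OO F n} (ha : a ∈ OddPart F p t) : TH F a ∈ WW F p t :=
  ⟨thc F a, fun s _ => ⟨pd_OT F p t _ (sig_OT F p t _ ha.1), by simpa using thc_odd F ha.2 s⟩,
    (TH_eq_vf F a).symm⟩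

variable (F p t) in
/-- The identification `T_H` of the odd part of `𝒪(n, n; t)` with `ℋ𝒪`. -/
noncomputable def toHO : OddPart F p t ≃ₗ[F] HO F p t :=
  LinearEquiv.ofBijective
    (LinearMap.codRestrict (HO F p t).toSubmodule
      (LinearMap.codRestrict (WW F p t).toSubmodule (TH F ∘ₗ (OddPart F p t).subtype)
        fun a => TH_mem_WW a.2)
      fun a => ⟨a, a.2.1, rfl⟩) <| by
    refine ⟨fun a b h => Subtype.ext <| TH_injOn_OddPart a.2 b.2 <|
      congrArg (fun x : HO F p t => ((x : WW F p t) : Module.End F (OO F n))) h, ?_⟩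
    rintro ⟨⟨x, hx⟩, hxa⟩
    obtain ⟨a, ha, rfl : TH F a = x⟩ := hxa
    obtain ⟨b, hb, h⟩ := exists_odd F p t ha hx
    exact ⟨⟨b, hb⟩, Subtype.ext (Subtype.ext h)⟩

theorem lie_toHO (a b : OddPart F p t) :
    ⁅toHO F p t a, toHO F p t b⁆ = toHO F p t ⟨TH F (a : OO F n) b, TH_mem_OddPart a.2 b.2⟩ :=
  Subtype.ext (Subtype.ext (lie_TH F a.2.2 b.2.2))

theorem toHO_mem_HOdeg {a : OddPart F p t} :
    toHO F p t a ∈ HOdeg F p t k ↔ (a : OO F n) ∈ homog F (k + 2) := by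
  constructor
  · rintro ⟨f, hf, hfa⟩
    obtain rfl : f = thc F (a : OO F n) := vf_injective F (hfa.trans (TH_eq_vf F (a : OO F n)))
    rw [show k + 2 = k + 1 + 1 by ring]
    refine homog_of_pd (fun r => ?_) (apply_empty_eq_zero a.2 0)
    have h := hf r.swap trivial
    rw [OTdeg_eq, thc_eq_smul_pd a.2.2, Sum.swap_swap] at h
    exact (Submodule.smul_mem_iff _ (pow_ne_zero _ (neg_ne_zero.2 one_ne_zero))).1 h.2
  · intro h
    refine ⟨thc F (a : OO F n), fun s _ => ?_, (TH_eq_vf F (a : OO F n)).symm⟩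
    have hs := thc_homog h s
    rw [show k + 2 - 1 = k + 1 by ring] at hs
    rw [OTdeg_eq]
    exact ⟨pd_OT F p t _ (sig_OT F p t _ a.2.1), hs⟩

theorem exists_vf_eq_of_mem_Wdeg {E : WW F p t} (hE : E ∈ Wdeg F p t k) :
    ∃ f : Y n → OO F n, (∀ r, f r ∈ OT F p t ∧ f r ∈ homog F (k + 1) ∧ f r ∈ par F n (mu r)) ∧
      vf F f = E := by
  obtain ⟨f, hf, hfE⟩ := hE
  obtain ⟨g, hg, hgE⟩ := E.2
  obtain rfl : f = g := vf_injective F (hfE.trans hgE.symm)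
  refine ⟨f, fun r => ⟨(hg r trivial).1, ?_, by simpa using (hg r trivial).2⟩, hgE⟩
  have h := hf r trivial
  rw [OTdeg_eq] at h
  exact h.2

theorem lie_mem_Wdeg {l : ℤ} {D E : WW F p t} (hD : D ∈ Wdeg F p t k) (hE : E ∈ Wdeg F p t l) :
    ⁅D, E⁆ ∈ Wdeg F p t (k + l) := by
  obtain ⟨f, hf, hfD⟩ := exists_vf_eq_of_mem_Wdeg hD
  obtain ⟨g, hg, hgE⟩ := exists_vf_eq_of_mem_Wdeg hE
  refine ⟨fun s => vf F f (g s) - vf F g (f s), fun s _ => ?_, ?_⟩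
  · have hfg := vf_homog (fun r => (hf r).2.1) (hg s).2.1
    have hgf := vf_homog (fun r => (hg r).2.1) (hf s).2.1
    rw [show k + 1 + (l + 1 - 1) = k + l + 1 by ring] at hfg
    rw [show l + 1 + (k + 1 - 1) = k + l + 1 by ring] at hgf
    rw [OTdeg_eq]
    exact Submodule.sub_mem _ ⟨vf_OT F p t (fun r => (hf r).1) (hg s).1, hfg⟩
      ⟨vf_OT F p t (fun r => (hg r).1) (hf s).1, hgf⟩
  · rw [← lie_vf F (fun r => (hf r).2.2) (fun r => (hg r).2.2), hfD, hgE]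
    rfl

theorem Gam_mem_Wdeg : Gam F p t ∈ Wdeg F p t 0 := by
  refine ⟨_, ?_, rfl⟩
  rintro (i | i) -
  · exact Submodule.zero_mem _
  · rw [OTdeg_eq]
    exact ⟨(X_inr_mem_OddPart i).1, X_mem_homog (Sum.inr i)⟩

theorem coe_lie_Gam_toHO (a : OddPart F p t) :
    ((⁅Gam F p t, (toHO F p t a : WW F p t)⁆ : WW F p t) : Module.End F (OO F n)) =
      TH F (oddEuler F (a : OO F n) - (a : OO F n)) :=
  lie_oddEuler_TH a.2.2

theorem HOGam_le_normalizer : HOGam F p t ≤ (HO F p t).normalizer.toSubmodule := by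
  refine sup_le (HO F p t).le_normalizer ?_
  rw [Submodule.span_singleton_le_iff_mem]
  refine (LieSubalgebra.mem_normalizer_iff _ _).2 fun x hx => ?_
  obtain ⟨a, ha⟩ := (toHO F p t).surjective ⟨x, hx⟩
  obtain rfl : (toHO F p t a : WW F p t) = x := congrArg Subtype.val ha
  exact ⟨oddEuler F (a : OO F n) - a, Submodule.sub_mem _ (oddEuler_mem_supported a.2.1) a.2.1,
    (coe_lie_Gam_toHO a).symm⟩

end IsoHO

section Centralizer

variable {f : Y n → OO F n}

theorem vf_one (f : Y n → OO F n) : vf F f (mon F n 0 ∅) = 0 := by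
  rw [vf_apply]
  refine Finset.sum_eq_zero fun r _ => ?_
  rcases r with i | i <;> simp [pd_inl_mon, pd_inr_mon']

theorem vf_apply_apply_X {T : Module.End F (OO F n)} (h : Commute (vf F f) T) (s : Y n) :
    vf F f (T (X F n s)) = T (f s) := by
  rw [← vf_X F f s]
  exact LinearMap.congr_fun h (X F n s)

theorem coeff_apply_eq_zero_of_commute (h : ∀ i, Commute (vf F f) (TH F (X F n (Sum.inr i))))
    (s : Y n) {α : Fin n → ℕ} (hα : α ≠ 0) (u : Finset (Fin n)) : f s (α, u) = 0 := by
  obtain ⟨i, hi⟩ := Function.ne_iff.1 hα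
  have hs := vf_apply_apply_X (h i) s
  rw [TH_X_inr, TH_X_inr, pd_X, map_neg, apply_ite (vf F f), vf_one, map_zero, ite_self,
    neg_inj] at hs
  rw [apply_eq_pd_inl_apply hi, ← hs, Finsupp.zero_apply]

theorem weight_mul_coeff_of_commute {i : Fin n} (h : Commute (vf F f) (TH F (quad F i i)))
    {s : Y n} {β : Fin n → ℕ} {v : Finset (Fin n)} (hs : X F n s = mon F n β v)
    (x : (Fin n → ℕ) × Finset (Fin n)) : weight F i (β, v) * f s x = weight F i x * f s x := by
  have hX := vf_apply_apply_X h s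
  rw [hs, TH_quad_self_mon, ← hs, map_smul, vf_X] at hX
  rw [← TH_quad_self_apply, ← hX, Finsupp.smul_apply, smul_eq_mul]

theorem coeff_inl_eq_zero_of_commute (h2 : (2 : F) ≠ 0)
    (hX : ∀ i, Commute (vf F f) (TH F (X F n (Sum.inr i))))
    (hq : ∀ i, Commute (vf F f) (TH F (quad F i i))) (i : Fin n) : f (Sum.inl i) = 0 := by
  ext ⟨α, u⟩
  by_contra hne
  obtain rfl : α = 0 := of_not_not fun hα => hne (coeff_apply_eq_zero_of_commute hX _ hα u)
  have hw := mul_right_cancel₀ hne (weight_mul_coeff_of_commute (hq i) rfl (0, u))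
  simp only [weight, Finset.notMem_empty, if_false, Pi.single_eq_same, Nat.cast_one, Pi.zero_apply,
    Nat.cast_zero, sub_zero, zero_sub] at hw
  split_ifs at hw
  · exact h2 (by linear_combination -hw)
  · exact one_ne_zero (neg_eq_zero.1 hw)

theorem coeff_inr_eq_smul_of_commute (hX : ∀ i, Commute (vf F f) (TH F (X F n (Sum.inr i))))
    (hq : ∀ i, Commute (vf F f) (TH F (quad F i i))) (j : Fin n) :
    f (Sum.inr j) = f (Sum.inr j) (0, {j}) • X F n (Sum.inr j) := by
  ext ⟨α, u⟩
  rw [Finsupp.smul_apply, smul_eq_mul, X, mon_apply]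
  split_ifs with h
  · rw [← h, mul_one]
  rw [mul_zero]
  by_contra hne
  obtain rfl : α = 0 := of_not_not fun hα => hne (coeff_apply_eq_zero_of_commute hX _ hα u)
  refine h (Prod.ext rfl (Finset.ext fun i => ?_))
  have hw := mul_right_cancel₀ hne (weight_mul_coeff_of_commute (hq i) rfl (0, u))
  simp only [weight, Pi.zero_apply, Nat.cast_zero, sub_zero] at hw
  by_contra hi
  split_ifs at hw <;> simp_all

theorem exists_vf_eq_smul_oddEuler (h2 : (2 : F) ≠ 0)
    (hX : ∀ i, Commute (vf F f) (TH F (X F n (Sum.inr i))))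
    (hq : ∀ i j, Commute (vf F f) (TH F (quad F i j))) : ∃ c : F, vf F f = c • oddEuler F := by
  obtain ⟨c, hc⟩ : ∃ c : F, ∀ j, f (Sum.inr j) = c • X F n (Sum.inr j) := by
    rcases isEmpty_or_nonempty (Fin n) with _ | ⟨⟨i⟩⟩
    · exact ⟨0, isEmptyElim⟩
    refine ⟨f (Sum.inr i) (0, {i}), fun j => ?_⟩
    have hij : TH F (quad F i j) (X F n (Sum.inr i)) = X F n (Sum.inr j) := by
      rw [TH_quad, pd_X, pd_X, if_pos rfl, if_neg (by simp), map_zero, sub_zero, mul_X_left]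
    have h := vf_apply_apply_X (hq i j) (Sum.inr i)
    rw [coeff_inr_eq_smul_of_commute hX (fun l => hq l l) i, map_smul, hij, vf_X] at h
    exact h
  refine ⟨c, ?_⟩
  rw [oddEuler, ← map_smul]
  congr 1
  funext s
  rcases s with i | i
  · simp [coeff_inl_eq_zero_of_commute h2 hX (fun l => hq l l) i]
  · exact hc i

end Centralizer

section NonnegativeDegree

variable [Fact p.Prime] [CharP F p]

theorem mem_span_Gam_of_lie_HO_eq_zero (hp : 2 < p) (ht : ∀ i, 0 < t i) {E : WW F p t}
    (hE : ∀ x : HO F p t, ⁅E, (x : WW F p t)⁆ = 0) : E ∈ Submodule.span F {Gam F p t} := by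
  obtain ⟨f, -, hfE⟩ := E.2
  have h2 : (2 : F) ≠ 0 := Ring.two_ne_zero (by rw [ringChar.eq F p]; omega)
  have hcomm (a : OO F n) (ha : a ∈ OddPart F p t) : Commute (vf F f) (TH F a) := by
    rw [hfE]
    exact sub_eq_zero.1 (congrArg Subtype.val (hE (toHO F p t ⟨a, ha⟩)))
  obtain ⟨c, hc⟩ := exists_vf_eq_smul_oddEuler h2 (fun i => hcomm _ (X_inr_mem_OddPart i))
    (fun i j => hcomm _ (quad_mem_OddPart ht i j))
  exact Submodule.mem_span_singleton.2 ⟨c, Subtype.ext (hc.symm.trans hfE)⟩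

theorem normalizerAd_mem_DerDeg {E : WW F p t} (hE : E ∈ (HO F p t).normalizer)
    (hk : E ∈ Wdeg F p t k) : normalizerAd E hE ∈ DerDeg F p t k :=
  fun _ _ hx => lie_mem_Wdeg hk hx

theorem exists_isBracketDerivation {φ : LieDerivation F (HO F p t) (HO F p t)}
    (hφ : φ ∈ DerDeg F p t k) :
    ∃ (D : OO F n →ₗ[F] OO F n) (hD : IsBracketDerivation p t k D),
      ∀ a : OddPart F p t, φ (toHO F p t a) = toHO F p t ⟨D a, hD.map_mem a.2⟩ := by
  set e := toHO F p t
  obtain ⟨D, hD⟩ := LinearMap.exists_extend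
    ((OddPart F p t).subtype ∘ₗ e.symm.toLinearMap ∘ₗ φ.toLinearMap ∘ₗ e.toLinearMap)
  have hDa (a : OddPart F p t) : D a = e.symm (φ (e a)) := LinearMap.congr_fun hD a
  have hmem {a : OO F n} (ha : a ∈ OddPart F p t) : D a ∈ OddPart F p t := by
    rw [hDa ⟨a, ha⟩]
    exact Subtype.prop _
  have hφe (a : OddPart F p t) : φ (e a) = e ⟨D a, hmem a.2⟩ :=
    e.symm_apply_eq.1 (Subtype.ext (hDa a).symm)
  refine ⟨D, ⟨hmem, fun {a b} ha hb => ?_, fun {m a} ha ham => ?_⟩, hφe⟩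
  · have h := φ.apply_lie_eq_sub (e ⟨a, ha⟩) (e ⟨b, hb⟩)
    rw [hφe, hφe, lie_toHO, lie_toHO, lie_toHO, hφe, ← map_sub] at h
    refine (congrArg Subtype.val (e.injective h)).trans ?_
    rw [AddSubgroupClass.coe_sub, TH_skew F hb.2 (hmem ha).2, add_comm]
    exact sub_eq_add_neg _ _
  · have h := hφ (m - 2) (e ⟨a, ha⟩) (toHO_mem_HOdeg.2 (by simpa using ham))
    rw [hφe, toHO_mem_HOdeg] at h
    rwa [show k + (m - 2) + 2 = m + k by ring] at h

theorem exists_eq_lie_add_smul_Gam (hk : 0 ≤ k) (hp : 2 < p) (ht : ∀ i, 0 < t i)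
    {φ : LieDerivation F (HO F p t) (HO F p t)} (hφ : φ ∈ DerDeg F p t k) :
    ∃ y ∈ HOdeg F p t k, ∃ κ : F, (k ≠ 0 → κ = 0) ∧
      ∀ x : HO F p t, (φ x : WW F p t) = ⁅(y : WW F p t) + κ • Gam F p t, (x : WW F p t)⁆ := by
  obtain ⟨D, hD, hφD⟩ := exists_isBracketDerivation hφ
  obtain ⟨b, ⟨hb, hbk⟩, κ, hκ, h⟩ := hD.exists_eq_TH_add_smul_oddEuler_sub hk hp ht
  refine ⟨toHO F p t ⟨b, hb⟩, toHO_mem_HOdeg.2 hbk, κ, hκ, fun x => Subtype.ext ?_⟩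
  obtain ⟨a, rfl⟩ := (toHO F p t).surjective x
  rw [hφD, add_lie, smul_lie]
  change TH F (D a) = (TH F b * TH F (a : OO F n) - TH F (a : OO F n) * TH F b) +
    κ • ((⁅Gam F p t, (toHO F p t a : WW F p t)⁆ : WW F p t) : Module.End F (OO F n))
  rw [coe_lie_Gam_toHO, h a a.2, map_add, map_smul, lie_TH F hb.2 a.2.2]

theorem add_smul_Gam_mem_HOGam (y : HO F p t) (κ : F) :
    (y : WW F p t) + κ • Gam F p t ∈ HOGam F p t :=
  Submodule.add_mem_sup y.2 (Submodule.smul_mem _ _ (Submodule.mem_span_singleton_self _))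

theorem DerDeg_eq_map_ad (hk : 0 < k) (hp : 2 < p) (ht : ∀ i, 0 < t i) :
    DerDeg F p t k = (HOdeg F p t k).map (LieDerivation.ad F (HO F p t)).toLinearMap := by
  refine le_antisymm (fun φ hφ => ?_) ?_
  · obtain ⟨y, hy, κ, hκ, h⟩ := exists_eq_lie_add_smul_Gam hk.le hp ht hφ
    refine ⟨y, hy, LieDerivation.ext fun x => Subtype.ext ?_⟩
    rw [h x, hκ hk.ne', zero_smul, add_zero]
    exact congrArg Subtype.val (LieDerivation.ad_apply_apply F (HO F p t) y x)
  · rintro _ ⟨y, hy, rfl⟩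
    intro i x hx
    exact (LieDerivation.ad_apply_apply F (HO F p t) y x).symm ▸ lie_mem_Wdeg hy hx

theorem map_derIncl_DerDeg_zero (hp : 2 < p) (ht : ∀ i, 0 < t i) :
    (DerDeg F p t 0).map (derIncl F p t) =
      (HOGam F p t ⊓ Wdeg F p t 0).map (adHO F p t) := by
  refine le_antisymm ?_ ?_
  · rintro _ ⟨φ, hφ, rfl⟩
    obtain ⟨y, hy, κ, -, h⟩ := exists_eq_lie_add_smul_Gam le_rfl hp ht hφ
    exact ⟨y + κ • Gam F p t, ⟨add_smul_Gam_mem_HOGam y κ,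
      Submodule.add_mem _ hy (Submodule.smul_mem _ _ Gam_mem_Wdeg)⟩,
      LinearMap.ext fun x => (h x).symm⟩
  · rintro _ ⟨E, hE, rfl⟩
    exact ⟨normalizerAd E (HOGam_le_normalizer hE.1), normalizerAd_mem_DerDeg _ hE.2, rfl⟩

theorem normalizer_inf_Wdeg (hk : 0 ≤ k) (hp : 2 < p) (ht : ∀ i, 0 < t i) :
    (HO F p t).normalizer.toSubmodule ⊓ Wdeg F p t k = HOGam F p t ⊓ Wdeg F p t k := by
  refine le_antisymm (fun E hE => ⟨?_, hE.2⟩) (inf_le_inf_right _ HOGam_le_normalizer)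
  obtain ⟨y, -, κ, -, h⟩ :=
    exists_eq_lie_add_smul_Gam hk hp ht (normalizerAd_mem_DerDeg hE.1 hE.2)
  have hspan : E - (y + κ • Gam F p t) ∈ Submodule.span F {Gam F p t} :=
    mem_span_Gam_of_lie_HO_eq_zero hp ht fun x => by
      rw [sub_lie, sub_eq_zero]
      exact h x
  rw [← sub_add_cancel E ((y : WW F p t) + κ • Gam F p t)]
  exact Submodule.add_mem _ (Submodule.mem_sup_right hspan) (add_smul_Gam_mem_HOGam y κ)

end NonnegativeDegree

end OddHamiltonian

open OddHamiltonian in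
theorem mainTheorem7_general (F : Type*) [Field F] (p : ℕ) [Fact p.Prime] [CharP F p] (hp : 2 < p)
    (n : ℕ) (t : Fin n → ℕ) (ht : ∀ i, 0 < t i) :
    (∀ k : ℤ, 0 < k →
      DerDeg F p t k = (HOdeg F p t k).map (LieDerivation.ad F (HO F p t)).toLinearMap) ∧
    (DerDeg F p t 0).map (derIncl F p t) = (HOGam F p t ⊓ Wdeg F p t 0).map (adHO F p t) ∧
    (∀ k : ℤ, 0 ≤ k →
      (HO F p t).normalizer.toSubmodule ⊓ Wdeg F p t k = HOGam F p t ⊓ Wdeg F p t k) :=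
  ⟨fun _ hk => DerDeg_eq_map_ad hk hp ht, map_derIncl_DerDeg_zero hp ht,
    fun _ hk => normalizer_inf_Wdeg hk hp ht⟩

theorem mainTheorem7 (F : Type*) [Field F] (p : ℕ) [Fact p.Prime] [CharP F p] (hp : 3 < p)
    (n : ℕ) (hn : 3 ≤ n) (t : Fin n → ℕ) (ht : ∀ i, 0 < t i) :
    (∀ k : ℤ, 0 < k →
      OddHamiltonian.DerDeg F p t k =
        (OddHamiltonian.HOdeg F p t k).map
          (LieDerivation.ad F (OddHamiltonian.HO F p t)).toLinearMap) ∧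
    (OddHamiltonian.DerDeg F p t 0).map (OddHamiltonian.derIncl F p t) =
      (OddHamiltonian.HOGam F p t ⊓ OddHamiltonian.Wdeg F p t 0).map
        (OddHamiltonian.adHO F p t) ∧
    (∀ k : ℤ, 0 ≤ k →
      (OddHamiltonian.HO F p t).normalizer.toSubmodule ⊓ OddHamiltonian.Wdeg F p t k =
        OddHamiltonian.HOGam F p t ⊓ OddHamiltonian.Wdeg F p t k) :=
  mainTheorem7_general F p (by omega) n t ht
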